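/- Let $X$ be a smooth Riemannian manifold of dimension $n$ (Hausdorff, second countable, possibly with boundary, not necessarily orientable or connected), with volume measure $\mu_X$, and let $\Phi_I,\Phi_{II}$ be $N$-functions, i.e. even convex functions $\Phi:\mathbb R\to[0,\infty)$ with $\Phi(x)=0\iff x=0$, $\Phi(x)/x\to0$ as $x\to0$ and $\Phi(x)/x\to\infty$ as $x\to\infty$. For an $N$-function $\Phi$ let $L^\Phi(X,\Lambda^k)$ be the space of measurable $k$-forms $\omega$ on $X$ (identified if equal almost everywhere) such that $\int_X\Phi(\alpha|\omega|)\,d\mu_X<\infty$ for some $\alpha>0$, with the gauge norm $\|\omega\|_{(\Phi)}=\inf\{K>0:\int_X\Phi(|\omega|/K)\,d\mu_X\le1\}$; put $L^\Phi(X,\Lambda^{-1})=0$. A form $\theta\in L^{j+1}_{1,\mathrm{loc}}(X)$ is the (weak) differential $d\omega$ of $\omega\in L^{j}_{1,\mathrm{loc}}(X)$ if $$\int_U\omega\wedge du=(-1)^{j+1}\int_U\theta\wedge u$$ for every orientable domain $U\subset\operatorname{Int}X$ and every smooth $(n-j-1)$-form $u$ with compact support in $U$. Put $$Z^k_{\Phi_{II}}(X)=\{\omega\in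 L^{\Phi_{II}}(X,\Lambda^k):d\omega=0\},\qquad B^k_{\Phi_I,\Phi_{II}}(X)=\{\omega\in L^{\Phi_{II}}(X,\Lambda^k):\omega=d\beta\text{ for some }\beta\in L^{\Phi_I}(X,\Lambda^{k-1})\},$$ and $H^k_{\Phi_I,\Phi_{II}}(X)=Z^k_{\Phi_{II}}(X)/B^k_{\Phi_I,\Phi_{II}}(X)$. Theorem. For every integer $k\ge0$, $H^k_{\Phi_I,\Phi_{II}}(X)=0$ if and only if there is a constant $C<\infty$ such that for every closed form $\omega\in L^{\Phi_{II}}(X,\Lambda^k)$ (that is, $d\omega=0$) there is a form $\theta\in L^{\Phi_I}(X,\Lambda^{k-1})$ with $d\theta=\omega$ and $$\|\theta\|_{(\Phi_I)}\le C\,\|\omega\|_{(\Phi_{II})}.$$ -/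

import Mathlib

open scoped Manifold ContDiff Bundle Topology
open Bundle

set_option linter.unusedSectionVars false

noncomputable section

/-! ### `N`-functions -/

/-- An `N`-function: an even convex function `Φ : ℝ → [0, ∞)` that vanishes only at `0`, with
`Φ(x)/x → 0` as `x → 0` and `Φ(x)/x → ∞` as `x → ∞`. -/
structure NFunction where
  toFun : ℝ → ℝ
  nonneg : ∀ x, 0 ≤ toFun x
  even : ∀ x, toFun (-x) = toFun x
  convex : ConvexOn ℝ Set.univ toFun
  eq_zero_iff : ∀ x, toFun x = 0 ↔ x = 0
  tendsto_zero : Filter.Tendsto (fun x => toFun x / x) (𝓝[≠] 0) (𝓝 0)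
  tendsto_atTop : Filter.Tendsto (fun x => toFun x / x) Filter.atTop Filter.atTop

instance : CoeFun NFunction (fun _ => ℝ → ℝ) := ⟨NFunction.toFun⟩

namespace NFunction

theorem map_zero (Φ : NFunction) : Φ 0 = 0 := (Φ.eq_zero_iff 0).2 rfl

theorem mono (Φ : NFunction) {x y : ℝ} (hx : 0 ≤ x) (hxy : x ≤ y) : Φ x ≤ Φ y := by
  rcases hx.eq_or_lt with rfl | hx0
  · rw [Φ.map_zero]; exact Φ.nonneg y
  have hy : 0 < y := hx0.trans_le hxy
  have h := Φ.convex.2 (Set.mem_univ y) (Set.mem_univ 0) 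
    (show 0 ≤ x / y by positivity)
    (show 0 ≤ 1 - x / y by rw [sub_nonneg, div_le_one hy]; exact hxy) (by ring)
  simp only [smul_eq_mul, mul_zero, add_zero, Φ.map_zero, div_mul_cancel₀ _ hy.ne'] at h
  refine h.trans (mul_le_of_le_one_left (Φ.nonneg y) ?_)
  rw [div_le_one hy]; exact hxy

theorem add_le (Φ : NFunction) (x y : ℝ) : Φ (x + y) ≤ Φ (2 * x) + Φ (2 * y) := by
  have h := Φ.convex.2 (Set.mem_univ (2 * x)) (Set.mem_univ (2 * y)) 
    (show (0 : ℝ) ≤ 1 / 2 by norm_num) (show (0 : ℝ) ≤ 1 / 2 by norm_num) (by norm_num)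
  simp only [smul_eq_mul] at h
  rw [show (1 : ℝ) / 2 * (2 * x) + 1 / 2 * (2 * y) = x + y by ring] at h
  linarith [Φ.nonneg (2 * x), Φ.nonneg (2 * y)]

theorem continuous (Φ : NFunction) : Continuous Φ :=
  continuousOn_univ.1 (Φ.convex.continuousOn isOpen_univ)

end NFunction

/-! ### Exterior algebra on a Euclidean vector space -/

section LinearAlgebra

/-- The scalar product of two exterior `k`-forms on a Euclidean space `V`:
`(1 / k!) ∑ a(e_{i₁}, …, e_{i_k}) b(e_{i₁}, …, e_{i_k})`, the sum over all `k`-tuples of indices of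
an orthonormal basis `e`. By antisymmetry this is the sum over `i₁ < ⋯ < i_k` without the factor
`1 / k!`. It does not depend on the basis (`formInner_eq_gram` with an orthonormal `s`). -/
def formInner {V : Type*} [NormedAddCommGroup V] [InnerProductSpace ℝ V] [FiniteDimensional ℝ V]
    {k : ℕ} (a b : V [⋀^Fin k]→ₗ[ℝ] ℝ) : ℝ :=
  ((k.factorial : ℝ))⁻¹ * ∑ v : Fin k → Fin (Module.finrank ℝ V),
    a (fun i => stdOrthonormalBasis ℝ V (v i)) * b (fun i => stdOrthonormalBasis ℝ V (v i))

/-- The modulus `|a|` of an exterior form on a Euclidean space. -/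
def formNorm {V : Type*} [NormedAddCommGroup V] [InnerProductSpace ℝ V] [FiniteDimensional ℝ V]
    {k : ℕ} (a : V [⋀^Fin k]→ₗ[ℝ] ℝ) : ℝ :=
  Real.sqrt (formInner a a)

/-- The exterior product of a `j`-form and an `l`-form, where `j + l = n`:
`(a ∧ b)(v₁, …, vₙ) = ∑ sign(σ) a(v_{σ 1}, …, v_{σ j}) b(v_{σ (j+1)}, …, v_{σ n})`,
the sum over the `(j, l)`-shuffles `σ`. -/
def formWedge {V : Type*} [AddCommGroup V] [Module ℝ V] {j l n : ℕ} (h : j + l = n)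
    (a : V [⋀^Fin j]→ₗ[ℝ] ℝ) (b : V [⋀^Fin l]→ₗ[ℝ] ℝ) : V [⋀^Fin n]→ₗ[ℝ] ℝ :=
  ((LinearMap.mul' ℝ ℝ).compAlternatingMap (a.domCoprod b)).domDomCongr
    (finSumFinEquiv.trans (finCongr h))

variable {V : Type*} [NormedAddCommGroup V] [InnerProductSpace ℝ V] [FiniteDimensional ℝ V]

/-- The scalar product of `k`-forms in terms of an arbitrary basis and the inverse Gram matrix. -/
theorem formInner_eq_gram {ι : Type*} [Fintype ι] [DecidableEq ι] (s : Module.Basis ι ℝ V) {k : ℕ}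
    (a b : V [⋀^Fin k]→ₗ[ℝ] ℝ) :
    formInner a b = ((k.factorial : ℝ))⁻¹ * ∑ v : Fin k → ι, ∑ w : Fin k → ι,
      (∏ l, (Matrix.of fun i j => inner ℝ (s i) (s j))⁻¹ (v l) (w l)) *
        (a (fun l => s (v l)) * b (fun l => s (w l))) := by
  classical
  set e := stdOrthonormalBasis ℝ V with he
  -- coordinates of the orthonormal basis in the basis `s`, and conversely
  set N : Matrix (Fin (Module.finrank ℝ V)) ι ℝ := Matrix.of fun r i => s.repr (e r) i with hN
  set M : Matrix ι (Fin (Module.finrank ℝ V)) ℝ := Matrix.of fun i r => inner ℝ (e r) (s i) with hM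
  have hes : ∀ r, e r = ∑ i, N r i • s i := fun r => (s.sum_repr (e r)).symm
  have hse : ∀ i, s i = ∑ r, M i r • e r := fun i => (e.sum_repr' (s i)).symm
  have hG : (Matrix.of fun i j => inner ℝ (s i) (s j)) = M * M.transpose := by
    ext i j
    rw [Matrix.mul_apply, Matrix.of_apply, ← e.sum_inner_mul_inner (s i) (s j)]
    simp [hM, real_inner_comm]
  have hNM : M * N = 1 := by
    ext i j
    have h1 : s.repr (s i) j = ∑ r, M i r * N r j := by
      conv_lhs => rw [hse i]
      simp [hN, Finsupp.finsetSum_apply]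
    rw [Matrix.mul_apply, ← h1, s.repr_self, Matrix.one_apply, Finsupp.single_apply]
  have hcard : Fintype.card ι = Fintype.card (Fin (Module.finrank ℝ V)) := by
    rw [Fintype.card_fin, Module.finrank_eq_card_basis s]
  have hNM' : N * M = 1 := by
    exact (Matrix.mul_eq_one_comm_of_card_eq (R := ℝ) (eq := hcard)).1 hNM
  have hinv : (Matrix.of fun i j => inner ℝ (s i) (s j))⁻¹ = N.transpose * N := by
    rw [hG]
    apply Matrix.inv_eq_right_inv
    calc M * M.transpose * (N.transpose * N) = M * (M.transpose * N.transpose) * N := by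
          simp only [Matrix.mul_assoc]
      _ = 1 := by rw [← Matrix.transpose_mul, hNM', Matrix.transpose_one, Matrix.mul_one, hNM]
  rw [hinv]
  have expand : ∀ (f : V [⋀^Fin k]→ₗ[ℝ] ℝ) (u : Fin k → Fin (Module.finrank ℝ V)),
      f (fun l => e (u l)) = ∑ v : Fin k → ι, (∏ l, N (u l) (v l)) * f (fun l => s (v l)) := by
    intro f u
    have h1 : (fun l => e (u l)) = fun l => ∑ i, N (u l) i • s i := funext fun l => hes (u l)
    rw [h1]
    have := f.toMultilinearMap.map_sum (fun l i => N (u l) i • s i)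
    simp only [AlternatingMap.coe_multilinearMap] at this
    rw [this]
    refine Finset.sum_congr rfl fun v _ => ?_
    have := f.toMultilinearMap.map_smul_univ (fun l => N (u l) (v l)) (fun l => s (v l))
    simpa using this
  unfold formInner
  congr 1
  simp_rw [← he, expand, Finset.sum_mul_sum, Matrix.mul_apply, Matrix.transpose_apply,
    Finset.prod_univ_sum, Fintype.piFinset_univ, Finset.sum_mul, Finset.prod_mul_distrib]
  rw [Finset.sum_comm]
  refine Finset.sum_congr rfl fun v _ => ?_
  rw [Finset.sum_comm]
  refine Finset.sum_congr rfl fun w _ => Finset.sum_congr rfl fun u _ => by ring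

theorem formNorm_eq_norm {k : ℕ} (a : V [⋀^Fin k]→ₗ[ℝ] ℝ) :
    formNorm a = Real.sqrt ((k.factorial : ℝ))⁻¹ * ‖(WithLp.toLp 2 fun v : Fin k → Fin (Module.finrank ℝ V) =>
      a fun i => stdOrthonormalBasis ℝ V (v i) : EuclideanSpace ℝ _)‖ := by
  rw [formNorm, formInner, Real.sqrt_mul (by positivity), EuclideanSpace.norm_eq]
  simp [sq]

theorem formNorm_nonneg {k : ℕ} (a : V [⋀^Fin k]→ₗ[ℝ] ℝ) : 0 ≤ formNorm a := Real.sqrt_nonneg _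

theorem formNorm_add_le {k : ℕ} (a b : V [⋀^Fin k]→ₗ[ℝ] ℝ) :
    formNorm (a + b) ≤ formNorm a + formNorm b := by
  simp only [formNorm_eq_norm, ← mul_add]
  refine mul_le_mul_of_nonneg_left ?_ (Real.sqrt_nonneg _)
  exact norm_add_le (WithLp.toLp 2 fun v : Fin k → Fin (Module.finrank ℝ V) =>
    a fun i => stdOrthonormalBasis ℝ V (v i) : EuclideanSpace ℝ _) (WithLp.toLp 2 fun v => _)

theorem formNorm_smul {k : ℕ} (c : ℝ) (a : V [⋀^Fin k]→ₗ[ℝ] ℝ) :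
    formNorm (c • a) = |c| * formNorm a := by
  simp only [formNorm_eq_norm]
  rw [mul_left_comm, ← Real.norm_eq_abs, ← norm_smul]
  rfl

theorem formInner_add_left {k : ℕ} (a a' b : V [⋀^Fin k]→ₗ[ℝ] ℝ) :
    formInner (a + a') b = formInner a b + formInner a' b := by
  simp only [formInner, AlternatingMap.add_apply, add_mul, Finset.sum_add_distrib, mul_add]

theorem formInner_smul_left {k : ℕ} (c : ℝ) (a b : V [⋀^Fin k]→ₗ[ℝ] ℝ) :
    formInner (c • a) b = c * formInner a b := by
  simp only [formInner, AlternatingMap.smul_apply, smul_eq_mul, Finset.mul_sum]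
  exact Finset.sum_congr rfl fun v _ => by ring

theorem formWedge_add_left {V : Type*} [AddCommGroup V] [Module ℝ V] {j l n : ℕ} (h : j + l = n)
    (a a' : V [⋀^Fin j]→ₗ[ℝ] ℝ) (b : V [⋀^Fin l]→ₗ[ℝ] ℝ) :
    formWedge h (a + a') b = formWedge h a b + formWedge h a' b := by
  ext v
  simp [formWedge, ← AlternatingMap.domCoprod'_apply, TensorProduct.add_tmul]

theorem formWedge_smul_left {V : Type*} [AddCommGroup V] [Module ℝ V] {j l n : ℕ} (h : j + l = n)
    (c : ℝ) (a : V [⋀^Fin j]→ₗ[ℝ] ℝ) (b : V [⋀^Fin l]→ₗ[ℝ] ℝ) :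
    formWedge h (c • a) b = c • formWedge h a b := by
  ext v
  simp only [formWedge, ← AlternatingMap.domCoprod'_apply, ← TensorProduct.smul_tmul', map_smul]
  simp

end LinearAlgebra

/-! ### Differential forms on a Riemannian manifold -/

section Manifold

variable {n : ℕ} {H : Type*} [TopologicalSpace H]
  (I : ModelWithCorners ℝ (EuclideanSpace ℝ (Fin n)) H)
  {X : Type*} [TopologicalSpace X] [ChartedSpace H X] [IsManifold I ∞ X]

instance instFiniteDimensionalTangentSpace (x : X) : FiniteDimensional ℝ (TangentSpace I x) :=
  inferInstanceAs (FiniteDimensional ℝ (EuclideanSpace ℝ (Fin n)))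

variable (X) in
/-- (Not necessarily measurable) differential `k`-forms on `X`. -/
abbrev DForm (k : ℕ) : Type _ := (x : X) → TangentSpace I x [⋀^Fin k]→L[ℝ] ℝ

instance DForm.instAddCommGroup (k : ℕ) : AddCommGroup (DForm I X k) := inferInstance

/-- The isomorphism `ℝⁿ → T_p X` that sends the standard basis to the coordinate vectors at `p` of
the chart around `c`; here `p` is in the domain of this chart. It is the derivative of the inverse
of the chart, see `TangentBundle.symmL_trivializationAt`. -/
def coordFrame (c p : X) : EuclideanSpace ℝ (Fin n) →L[ℝ] TangentSpace I p :=
  (trivializationAt (EuclideanSpace ℝ (Fin n)) (TangentSpace I) c).symmL ℝ p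

theorem coordFrame_bijective {c p : X} (hp : p ∈ (chartAt H c).source) :
    Function.Bijective (coordFrame I c p) := by
  have hp' : p ∈ (trivializationAt (EuclideanSpace ℝ (Fin n)) (TangentSpace I) c).baseSet := by
    simpa using hp
  have := ((trivializationAt (EuclideanSpace ℝ (Fin n)) (TangentSpace I) c).continuousLinearEquivAt
    ℝ p hp').symm.bijective
  rwa [Bundle.Trivialization.symm_continuousLinearEquivAt_eq] at this

/-- The basis of coordinate vectors. -/
def coordBasis {c p : X} (hp : p ∈ (chartAt H c).source) :
    Module.Basis (Fin n) ℝ (TangentSpace I p) :=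
  (EuclideanSpace.basisFun (Fin n) ℝ).toBasis.map
    (LinearEquiv.ofBijective (coordFrame I c p).toLinearMap (coordFrame_bijective I hp))

theorem coordBasis_apply {c p : X} (hp : p ∈ (chartAt H c).source) (i : Fin n) :
    coordBasis I hp i = coordFrame I c p (EuclideanSpace.single i 1) := by
  simp [coordBasis]

theorem continuousOn_coordFrame (c : X) (v : EuclideanSpace ℝ (Fin n)) :
    ContinuousOn (fun p => (⟨p, coordFrame I c p v⟩ :
      Bundle.TotalSpace (EuclideanSpace ℝ (Fin n)) (TangentSpace I : X → Type _)))
      (chartAt H c).source := by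
  set e := trivializationAt (EuclideanSpace ℝ (Fin n)) (TangentSpace I : X → Type _) c with he
  have h1 := e.continuousOn_symm.comp (s := e.baseSet)
      (f := fun p : X => (p, v)) (Continuous.continuousOn (by fun_prop))
      fun p hp => ⟨hp, Set.mem_univ _⟩
  have hb : (chartAt H c).source = e.baseSet := by rw [he]; simp
  rw [hb]
  refine h1.congr fun p hp => ?_
  simp only [coordFrame, ← he, Function.comp]
  rw [Bundle.Trivialization.symmL_apply _ hp]

/-- The expression of the form `w` in the chart around `c`, at a point `p` of its domain: its value
on tuples of coordinate vectors. -/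
def DForm.coord {k : ℕ} (w : DForm I X k) (c p : X) :
    EuclideanSpace ℝ (Fin n) [⋀^Fin k]→L[ℝ] ℝ :=
  (w p).compContinuousLinearMap (coordFrame I c p)

/-- The pullback of the form `w` under the inverse of the chart around `c`, a form on a subset
of `ℝⁿ` (the target of the chart). -/
def DForm.pull {k : ℕ} (w : DForm I X k) (c : X) (y : EuclideanSpace ℝ (Fin n)) :
    EuclideanSpace ℝ (Fin n) [⋀^Fin k]→L[ℝ] ℝ :=
  w.coord I c ((extChartAt I c).symm y)

/-- Smooth forms: the coefficients in every chart are smooth. -/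
def DForm.IsSmooth {k : ℕ} (w : DForm I X k) : Prop :=
  ∀ c : X, ContDiffOn ℝ ∞ (w.pull I c) (extChartAt I c).target

/-- The (classical) exterior differential of a form, computed at `x` in the chart around `x`. -/
def DForm.extDiff {k : ℕ} (w : DForm I X k) : DForm I X (k + 1) := fun x =>
  (extDerivWithin (w.pull I x) (Set.range I) (extChartAt I x x)).compContinuousLinearMap
    ((trivializationAt (EuclideanSpace ℝ (Fin n)) (TangentSpace I) x).continuousLinearMapAt ℝ x)

/-- `u ∈ D^m(X)` with support in `U`: smooth forms with compact support contained in `U`. -/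
def DForm.IsTestForm {m : ℕ} (u : DForm I X m) (U : Set X) : Prop :=
  u.IsSmooth I ∧ IsCompact (closure {x | u x ≠ 0}) ∧ closure {x | u x ≠ 0} ⊆ U

variable [RiemannianBundle (fun x : X => TangentSpace I x)]

/-- The modulus function `x ↦ |w(x)|` of a form. -/
def DForm.modulus {k : ℕ} (w : DForm I X k) (x : X) : ℝ :=
  formNorm (w x).toAlternatingMap

theorem DForm.modulus_add_le {k : ℕ} (w θ : DForm I X k) (x : X) :
    (w + θ).modulus I x ≤ w.modulus I x + θ.modulus I x :=
  formNorm_add_le (V := TangentSpace I x) (w x).toAlternatingMap (θ x).toAlternatingMap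

theorem DForm.modulus_smul {k : ℕ} (c : ℝ) (w : DForm I X k) (x : X) :
    (c • w).modulus I x = |c| * w.modulus I x :=
  formNorm_smul (V := TangentSpace I x) c (w x).toAlternatingMap

theorem DForm.modulus_zero {k : ℕ} (x : X) : (0 : DForm I X k).modulus I x = 0 := by
  simpa using DForm.modulus_smul I 0 (0 : DForm I X k) x

theorem DForm.modulus_nonneg {k : ℕ} (w : DForm I X k) (x : X) : 0 ≤ w.modulus I x :=
  formNorm_nonneg _

/-- The coefficients `g_{ij}(p) = ⟨∂_i, ∂_j⟩` of the metric in the chart around `c`. -/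
def metricMatrix (c p : X) : Matrix (Fin n) (Fin n) ℝ :=
  Matrix.of fun i j => inner ℝ (coordFrame I c p (EuclideanSpace.single i 1))
    (coordFrame I c p (EuclideanSpace.single j 1))

theorem continuousOn_metricMatrix
    [IsContMDiffRiemannianBundle I ∞ (EuclideanSpace ℝ (Fin n)) (fun x : X => TangentSpace I x)]
    (c : X) :
    ContinuousOn (metricMatrix I c) (chartAt H c).source := by
  have : IsContinuousRiemannianBundle (EuclideanSpace ℝ (Fin n))
    (fun x : X => TangentSpace I x) := by
    obtain ⟨g, hg, hg'⟩ := IsContMDiffRiemannianBundle.exists_contMDiff (IB := I) (n := ∞)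
      (F := EuclideanSpace ℝ (Fin n)) (E := fun x : X => TangentSpace I x)
    exact ⟨g, hg.continuous, hg'⟩
  refine continuousOn_pi.2 fun i => continuousOn_pi.2 fun j => ?_
  exact ContinuousOn.inner_bundle (continuousOn_coordFrame I c _) (continuousOn_coordFrame I c _)

/-- A Riemannian volume form on an open set `U`: a continuous `n`-form on `U` of modulus `1`
everywhere. Such forms correspond to the orientations of `U`; one exists iff `U` is orientable. -/
def IsVolumeForm (ν : DForm I X n) (U : Set X) : Prop :=
  (∀ c : X, ContinuousOn (ν.coord I c) (U ∩ (chartAt H c).source)) ∧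
    ∀ x ∈ U, ν.modulus I x = 1

variable [MeasurableSpace X] [BorelSpace X]

variable (X) in
/-- The Riemannian volume measure `μ_X`, on the domain of each chart given by
`√(det g_{ij}) dy¹ ⋯ dyⁿ`. These local measures agree on overlaps of charts, and their supremum in
the lattice of measures is the measure obtained by gluing them. -/
def riemannianVolume : MeasureTheory.Measure X :=
  ⨆ c : X, ((MeasureTheory.volume.restrict (extChartAt I c).target).withDensity
    (fun y => ENNReal.ofReal
      (Real.sqrt (metricMatrix I c ((extChartAt I c).symm y)).det))).map (extChartAt I c).symm

/-- Measurable forms: the coefficients in every chart are measurable (up to a null set). -/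
def DForm.IsMeasurable {k : ℕ} (w : DForm I X k) : Prop :=
  ∀ c : X, MeasureTheory.AEStronglyMeasurable (w.coord I c)
    ((riemannianVolume I X).restrict (chartAt H c).source)

theorem DForm.IsMeasurable.aemeasurable_modulus [SecondCountableTopology X]
    [IsContMDiffRiemannianBundle I ∞ (EuclideanSpace ℝ (Fin n)) (fun x : X => TangentSpace I x)]
    {k : ℕ} {w : DForm I X k}
    (hw : w.IsMeasurable I) : AEMeasurable (w.modulus I) (riemannianVolume I X) := by
  obtain ⟨t, ht, htU⟩ := TopologicalSpace.countable_cover_nhds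
    (fun x : X => chart_source_mem_nhds H x)
  have hloc : ∀ c : X, AEMeasurable (w.modulus I)
      ((riemannianVolume I X).restrict (chartAt H c).source) := by
    intro c
    have hS : MeasurableSet (chartAt H c).source := (chartAt H c).open_source.measurableSet
    set μ := (riemannianVolume I X).restrict (chartAt H c).source with hμ
    have hc : ∀ v : Fin k → Fin n,
        AEMeasurable (fun p => w.coord I c p fun l => EuclideanSpace.single (v l) 1) μ := by
      intro v
      have hcont : Continuous fun f : EuclideanSpace ℝ (Fin n) [⋀^Fin k]→L[ℝ] ℝ =>
          f fun l => EuclideanSpace.single (v l) 1 := by fun_prop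
      exact (hcont.comp_aestronglyMeasurable (hw c)).aemeasurable
    have hG : ContinuousOn (fun p => (metricMatrix I c p)) (chartAt H c).source :=
      continuousOn_metricMatrix I c
    have hGi : ∀ i j, AEMeasurable (fun p => (metricMatrix I c p)⁻¹ i j) μ := by
      intro i j
      have h1 : AEMeasurable (fun p => (metricMatrix I c p).det) μ :=
        (Continuous.comp_continuousOn (continuous_id.matrix_det) hG).aemeasurable hS
      have h2 : AEMeasurable (fun p => (metricMatrix I c p).adjugate i j) μ :=
        (Continuous.comp_continuousOn
          ((continuous_id.matrix_adjugate).matrix_elem i j) hG).aemeasurable hS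
      simp only [Matrix.inv_def, Ring.inverse_eq_inv', Matrix.smul_apply, smul_eq_mul]
      exact h1.inv.mul h2
    have key : AEMeasurable (fun p => Real.sqrt (((k.factorial : ℝ))⁻¹ *
        ∑ v : Fin k → Fin n, ∑ v' : Fin k → Fin n,
          (∏ l, (metricMatrix I c p)⁻¹ (v l) (v' l)) *
          ((w.coord I c p fun l => EuclideanSpace.single (v l) 1) *
            (w.coord I c p fun l => EuclideanSpace.single (v' l) 1)))) μ := by
      refine AEMeasurable.sqrt (AEMeasurable.const_mul ?_ _)
      refine Finset.aemeasurable_fun_sum _ fun v _ => Finset.aemeasurable_fun_sum _ fun v' _ => ?_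
      exact (Finset.aemeasurable_fun_prod _ fun l _ => hGi _ _).mul ((hc v).mul (hc v'))
    refine key.congr ?_
    filter_upwards [MeasureTheory.ae_restrict_mem hS] with p hp
    rw [DForm.modulus, formNorm, formInner_eq_gram (coordBasis I hp)]
    simp only [coordBasis_apply]
    rfl
  rw [← MeasureTheory.Measure.restrict_univ (μ := riemannianVolume I X), ← htU]
  have := ht.to_subtype
  rw [Set.biUnion_eq_iUnion]
  exact aemeasurable_iUnion_iff.2 fun c => hloc c

/-- `L^k_{1,loc}(X)`. -/
def DForm.IsLocallyIntegrable {k : ℕ} (w : DForm I X k) : Prop :=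
  w.IsMeasurable I ∧ MeasureTheory.LocallyIntegrable (w.modulus I) (riemannianVolume I X)

/-- The integrand of `∫_U η` for an `n`-form `η` on an open set `U` oriented by the volume form `ν`:
the function `f = (η, ν)` with `η = f ν` on `U`, so that `∫_U η = ∫_U f dμ_X`. -/
def topIntegrand (ν : DForm I X n) (η : (x : X) → TangentSpace I x [⋀^Fin n]→ₗ[ℝ] ℝ) (x : X) : ℝ :=
  formInner (η x) (ν x).toAlternatingMap

/-- `θ` is the weak differential of `w`: both are locally integrable, and
`∫_U w ∧ du = (-1)^{j+1} ∫_U θ ∧ u` for every orientable domain `U` in the interior of `X` (with an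
orientation, given by its volume form `ν`) and all smooth `(n-j-1)`-forms `u` with compact support
in `U`. We record that these two integrals converge. For `j = n` there is no test form, and
`θ = 0`, being an `(n+1)`-form. -/
def IsWeakDifferential {j : ℕ} (w : DForm I X j) (θ : DForm I X (j + 1)) : Prop :=
  w.IsLocallyIntegrable I ∧ θ.IsLocallyIntegrable I ∧
  ∀ (m : ℕ) (h₁ : j + (m + 1) = n) (h₂ : (j + 1) + m = n) (U : Set X),
    IsOpen U → IsConnected U → U ⊆ I.interior X →
    ∀ ν : DForm I X n, IsVolumeForm I ν U →
    ∀ u : DForm I X m, u.IsTestForm I U →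
      let f := topIntegrand I ν fun x =>
        formWedge h₁ (w x).toAlternatingMap (u.extDiff I x).toAlternatingMap
      let g := topIntegrand I ν fun x =>
        formWedge h₂ (θ x).toAlternatingMap (u x).toAlternatingMap
      MeasureTheory.IntegrableOn f U (riemannianVolume I X) ∧
      MeasureTheory.IntegrableOn g U (riemannianVolume I X) ∧
      ∫ x in U, f x ∂(riemannianVolume I X) =
        (-1) ^ (j + 1) * ∫ x in U, g x ∂(riemannianVolume I X)

/-! ### Orlicz spaces of forms -/

/-- `ρ_Φ(w) = ∫_X Φ(|w(x)|) dμ_X`. -/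
def rho (Φ : NFunction) {k : ℕ} (w : DForm I X k) : ENNReal :=
  ∫⁻ x, ENNReal.ofReal (Φ (w.modulus I x)) ∂(riemannianVolume I X)

/-- `w ∈ L^Φ(X, Λ^k)`. -/
def MemOrlicz (Φ : NFunction) {k : ℕ} (w : DForm I X k) : Prop :=
  w.IsMeasurable I ∧ ∃ α : ℝ, 0 < α ∧ rho I Φ (α • w) < (⊤ : ENNReal)

/-- The gauge norm `‖w‖_(Φ) = inf {K > 0 : ρ_Φ(w / K) ≤ 1}`. -/
def gaugeNorm (Φ : NFunction) {k : ℕ} (w : DForm I X k) : ℝ :=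
  sInf {K : ℝ | 0 < K ∧ rho I Φ (K⁻¹ • w) ≤ 1}

/-! ### Linearity of measurability, integrability and the weak differential -/

section Linear

variable {I}

theorem DForm.IsMeasurable.add {k : ℕ} {w θ : DForm I X k} (hw : w.IsMeasurable I)
    (hθ : θ.IsMeasurable I) : (w + θ).IsMeasurable I :=
  fun c => (hw c).add (hθ c)

theorem DForm.IsMeasurable.smul {k : ℕ} {w : DForm I X k} (r : ℝ) (hw : w.IsMeasurable I) :
    (r • w).IsMeasurable I :=
  fun c => (hw c).const_smul r

theorem DForm.IsMeasurable.zero {k : ℕ} : (0 : DForm I X k).IsMeasurable I :=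
  fun _ => MeasureTheory.aestronglyMeasurable_zero

theorem DForm.IsLocallyIntegrable.smul {k : ℕ} {w : DForm I X k} (r : ℝ)
    (hw : w.IsLocallyIntegrable I) : (r • w).IsLocallyIntegrable I := by
  refine ⟨hw.1.smul r, ?_⟩
  have : (r • w).modulus I = |r| • w.modulus I := funext fun x => DForm.modulus_smul I r w x
  rw [this]
  exact hw.2.smul |r|

theorem DForm.IsLocallyIntegrable.zero {k : ℕ} : (0 : DForm I X k).IsLocallyIntegrable I := by
  refine ⟨DForm.IsMeasurable.zero, ?_⟩
  have : (0 : DForm I X k).modulus I = 0 := funext fun x => DForm.modulus_zero I x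
  rw [this]
  exact MeasureTheory.locallyIntegrable_zero

theorem MemOrlicz.zero (Φ : NFunction) {k : ℕ} : MemOrlicz I Φ (0 : DForm I X k) := by
  refine ⟨DForm.IsMeasurable.zero, 1, one_pos, ?_⟩
  simp [rho, DForm.modulus_zero, Φ.map_zero]

theorem MemOrlicz.smul {Φ : NFunction} {k : ℕ} {w : DForm I X k} (r : ℝ)
    (hw : MemOrlicz I Φ w) : MemOrlicz I Φ (r • w) := by
  rcases eq_or_ne r 0 with rfl | hr
  · rw [zero_smul]; exact MemOrlicz.zero Φ
  obtain ⟨hm, α, hα, h⟩ := hw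
  refine ⟨hm.smul r, α / |r|, by positivity, ?_⟩
  have : rho I Φ ((α / |r|) • r • w) = rho I Φ (α • w) := by
    simp only [rho, DForm.modulus_smul]
    congr 1
    funext x
    rw [abs_div, abs_abs, ← mul_assoc, div_mul_cancel₀ _ (abs_ne_zero.2 hr)]
  rwa [this]

theorem topIntegrand_wedge_add {j l : ℕ} (h : j + l = n) (ν : DForm I X n) (w w' : DForm I X j)
    (u : DForm I X l) :
    (topIntegrand I ν fun x => formWedge h ((w + w') x).toAlternatingMap (u x).toAlternatingMap) =
      (topIntegrand I ν fun x => formWedge h (w x).toAlternatingMap (u x).toAlternatingMap) +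
      topIntegrand I ν fun x => formWedge h (w' x).toAlternatingMap (u x).toAlternatingMap := by
  funext x
  rw [Pi.add_apply, topIntegrand, topIntegrand, topIntegrand, ← formInner_add_left,
    ← formWedge_add_left]
  rfl

theorem topIntegrand_wedge_smul {j l : ℕ} (h : j + l = n) (ν : DForm I X n) (r : ℝ)
    (w : DForm I X j) (u : DForm I X l) :
    (topIntegrand I ν fun x => formWedge h ((r • w) x).toAlternatingMap (u x).toAlternatingMap) =
      r • topIntegrand I ν fun x => formWedge h (w x).toAlternatingMap (u x).toAlternatingMap := by
  funext x
  rw [Pi.smul_apply, topIntegrand, topIntegrand, smul_eq_mul, ← formInner_smul_left,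
    ← formWedge_smul_left]
  rfl

theorem IsWeakDifferential.smul {j : ℕ} {w : DForm I X j} {θ : DForm I X (j + 1)} (r : ℝ)
    (h : IsWeakDifferential I w θ) : IsWeakDifferential I (r • w) (r • θ) := by
  refine ⟨h.1.smul r, h.2.1.smul r, fun m h₁ h₂ U hU hUc hUi ν hν u hu => ?_⟩
  obtain ⟨i₁, i₂, e⟩ := h.2.2 m h₁ h₂ U hU hUc hUi ν hν u hu
  simp only [topIntegrand_wedge_smul]
  refine ⟨i₁.smul r, i₂.smul r, ?_⟩
  simp only [Pi.smul_apply, smul_eq_mul, MeasureTheory.integral_const_mul, e]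
  ring

theorem IsWeakDifferential.zero {j : ℕ} :
    IsWeakDifferential I (0 : DForm I X j) (0 : DForm I X (j + 1)) := by
  refine ⟨.zero, .zero, fun m h₁ h₂ U hU hUc hUi ν hν u hu => ?_⟩
  have e₁ := topIntegrand_wedge_smul h₁ ν 0 (0 : DForm I X j) (u.extDiff I)
  have e₂ := topIntegrand_wedge_smul h₂ ν 0 (0 : DForm I X (j + 1)) u
  simp only [zero_smul] at e₁ e₂
  simp only [e₁, e₂]
  exact ⟨MeasureTheory.integrableOn_zero, MeasureTheory.integrableOn_zero, by simp⟩

variable [SecondCountableTopology X]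
  [IsContMDiffRiemannianBundle I ∞ (EuclideanSpace ℝ (Fin n)) (fun x : X => TangentSpace I x)]

theorem DForm.IsLocallyIntegrable.add {k : ℕ} {w θ : DForm I X k}
    (hw : w.IsLocallyIntegrable I) (hθ : θ.IsLocallyIntegrable I) :
    (w + θ).IsLocallyIntegrable I := by
  refine ⟨hw.1.add hθ.1, (hw.2.add hθ.2).mono
    ((hw.1.add hθ.1).aemeasurable_modulus I).aestronglyMeasurable (.of_forall fun x => ?_)⟩
  rw [Real.norm_of_nonneg (DForm.modulus_nonneg I _ x)]
  exact (DForm.modulus_add_le I w θ x).trans (le_abs_self _)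

theorem MemOrlicz.add {Φ : NFunction} {k : ℕ} {w θ : DForm I X k} (hw : MemOrlicz I Φ w)
    (hθ : MemOrlicz I Φ θ) : MemOrlicz I Φ (w + θ) := by
  obtain ⟨hwm, a, ha, hwa⟩ := hw
  obtain ⟨hθm, b, hb, hθb⟩ := hθ
  refine ⟨hwm.add hθm, min a b / 2, by positivity, ?_⟩
  have hle : rho I Φ ((min a b / 2) • (w + θ)) ≤ rho I Φ (a • w) + rho I Φ (b • θ) := by
    have hmeas : AEMeasurable (fun x => ENNReal.ofReal (Φ ((a • w).modulus I x)))
        (riemannianVolume I X) :=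
      ENNReal.measurable_ofReal.comp_aemeasurable
        (Φ.continuous.measurable.comp_aemeasurable ((hwm.smul a).aemeasurable_modulus I))
    rw [rho, rho, rho, ← MeasureTheory.lintegral_add_left' hmeas]
    refine MeasureTheory.lintegral_mono fun x => ?_
    rw [← ENNReal.ofReal_add (Φ.nonneg _) (Φ.nonneg _)]
    refine ENNReal.ofReal_le_ofReal ?_
    have hw0 := DForm.modulus_nonneg I w x
    have hθ0 := DForm.modulus_nonneg I θ x
    have hmin : 0 < min a b := lt_min ha hb
    simp only [DForm.modulus_smul, abs_of_pos ha, abs_of_pos hb, abs_of_pos (half_pos hmin)]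
    calc Φ (min a b / 2 * (w + θ).modulus I x)
        ≤ Φ (min a b / 2 * w.modulus I x + min a b / 2 * θ.modulus I x) := by
          refine Φ.mono (mul_nonneg (half_pos hmin).le (DForm.modulus_nonneg I _ x)) ?_
          rw [← mul_add]
          exact mul_le_mul_of_nonneg_left (DForm.modulus_add_le I w θ x) (half_pos hmin).le
      _ ≤ Φ (2 * (min a b / 2 * w.modulus I x)) + Φ (2 * (min a b / 2 * θ.modulus I x)) :=
          Φ.add_le _ _
      _ ≤ Φ (a * w.modulus I x) + Φ (b * θ.modulus I x) := by
          refine add_le_add (Φ.mono (by positivity) ?_) (Φ.mono (by positivity) ?_)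
          · rw [← mul_assoc, mul_div_cancel₀ _ two_ne_zero]
            exact mul_le_mul_of_nonneg_right (min_le_left a b) hw0
          · rw [← mul_assoc, mul_div_cancel₀ _ two_ne_zero]
            exact mul_le_mul_of_nonneg_right (min_le_right a b) hθ0
  exact hle.trans_lt (ENNReal.add_lt_top.2 ⟨hwa, hθb⟩)

theorem IsWeakDifferential.add {j : ℕ} {w w' : DForm I X j} {θ θ' : DForm I X (j + 1)}
    (h : IsWeakDifferential I w θ) (h' : IsWeakDifferential I w' θ') :
    IsWeakDifferential I (w + w') (θ + θ') := by
  refine ⟨h.1.add h'.1, h.2.1.add h'.2.1, fun m h₁ h₂ U hU hUc hUi ν hν u hu => ?_⟩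
  obtain ⟨i₁, i₂, e⟩ := h.2.2 m h₁ h₂ U hU hUc hUi ν hν u hu
  obtain ⟨i₁', i₂', e'⟩ := h'.2.2 m h₁ h₂ U hU hUc hUi ν hν u hu
  simp only [topIntegrand_wedge_add]
  refine ⟨i₁.add i₁', i₂.add i₂', ?_⟩
  simp only [Pi.add_apply]
  rw [MeasureTheory.integral_add i₁ i₁', MeasureTheory.integral_add i₂ i₂', e, e']
  ring

end Linear

/-! ### Orlicz cohomology

Forms are represented by functions on `X`; two forms are identified if they agree almost everywhere.
All notions above respect this identification, and the space `B^k` below contains every form that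
vanishes almost everywhere, so that `Z^k / B^k` is the same for forms as for their classes. -/

/-- Forms of degree `k - 1`; for `k = 0` the zero space `Λ^{-1} = 0`. -/
def PrevDForm {n : ℕ} {H : Type*} [TopologicalSpace H]
    (I : ModelWithCorners ℝ (EuclideanSpace ℝ (Fin n)) H)
    (X : Type*) [TopologicalSpace X] [ChartedSpace H X] : ℕ → Type _
  | 0 => PUnit
  | k + 1 => DForm I X k

/-- `θ ∈ L^Φ(X, Λ^{k-1})`, where `L^Φ(X, Λ^{-1}) = 0`. -/
def MemOrliczPrev (Φ : NFunction) : (k : ℕ) → PrevDForm I X k → Prop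
  | 0, _ => True
  | _ + 1, θ => MemOrlicz I Φ θ

/-- The gauge norm on `L^Φ(X, Λ^{k-1})`, where `L^Φ(X, Λ^{-1}) = 0`. -/
def gaugeNormPrev (Φ : NFunction) : (k : ℕ) → PrevDForm I X k → ℝ
  | 0, _ => 0
  | _ + 1, θ => gaugeNorm I Φ θ

/-- `dθ = w` for a `(k-1)`-form `θ` and a `k`-form `w`: `w` is the weak differential of `θ`; for
`k = 0` this means that `w = 0` almost everywhere. -/
def IsWeakDifferentialPrev : (k : ℕ) → PrevDForm I X k → DForm I X k → Prop
  | 0, _, w => ∀ᵐ x ∂(riemannianVolume I X), w x = 0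
  | _ + 1, θ, w => IsWeakDifferential I θ w

variable (X) [SecondCountableTopology X]
  [IsContMDiffRiemannianBundle I ∞ (EuclideanSpace ℝ (Fin n)) (fun x : X => TangentSpace I x)]

/-- `Z^k_Φ(X) = {w ∈ L^Φ(X, Λ^k) : dw = 0}`. -/
def orliczCocycles (Φ : NFunction) (k : ℕ) : Submodule ℝ (DForm I X k) where
  carrier := {w | MemOrlicz I Φ w ∧ IsWeakDifferential I w 0}
  add_mem' h h' := ⟨h.1.add h'.1, by simpa using h.2.add h'.2⟩
  zero_mem' := ⟨.zero Φ, .zero⟩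
  smul_mem' r _ h := ⟨h.1.smul r, by simpa using h.2.smul r⟩

/-- `B^k_{Φ₁,Φ₂}(X) = {w ∈ L^{Φ₂}(X, Λ^k) : w = dθ for some θ ∈ L^{Φ₁}(X, Λ^{k-1})}`. -/
def orliczCoboundaries (Φ₁ Φ₂ : NFunction) (k : ℕ) : Submodule ℝ (DForm I X k) where
  carrier := {w | MemOrlicz I Φ₂ w ∧
    ∃ θ : PrevDForm I X k, MemOrliczPrev I Φ₁ k θ ∧ IsWeakDifferentialPrev I k θ w}
  add_mem' := by
    rintro w w' ⟨hw, θ, hθ, hd⟩ ⟨hw', θ', hθ', hd'⟩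
    refine ⟨hw.add hw', ?_⟩
    cases k with
    | zero =>
      refine ⟨PUnit.unit, trivial, ?_⟩
      filter_upwards [hd, hd'] with x hx hx'
      rw [Pi.add_apply, hx, hx', add_zero]
    | succ k =>
      change DForm I X k at θ θ'
      change MemOrlicz I Φ₁ θ at hθ
      change MemOrlicz I Φ₁ θ' at hθ'
      change IsWeakDifferential I θ w at hd
      change IsWeakDifferential I θ' w' at hd'
      have h1 : MemOrlicz I Φ₁ (θ + θ') := hθ.add hθ'
      have h2 : IsWeakDifferential I (θ + θ') (w + w') := hd.add hd'
      exact ⟨θ + θ', h1, h2⟩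
  zero_mem' := by
    refine ⟨.zero Φ₂, ?_⟩
    cases k with
    | zero => exact ⟨PUnit.unit, trivial, Filter.Eventually.of_forall fun _ => rfl⟩
    | succ k =>
      have h1 : MemOrlicz I Φ₁ (0 : DForm I X k) := .zero Φ₁
      have h2 : IsWeakDifferential I (0 : DForm I X k) 0 := .zero
      exact ⟨(0 : DForm I X k), h1, h2⟩
  smul_mem' := by
    rintro r w ⟨hw, θ, hθ, hd⟩
    refine ⟨hw.smul r, ?_⟩
    cases k with
    | zero =>
      refine ⟨PUnit.unit, trivial, ?_⟩
      filter_upwards [hd] with x hx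
      rw [Pi.smul_apply, hx, smul_zero]
    | succ k =>
      change DForm I X k at θ
      change MemOrlicz I Φ₁ θ at hθ
      change IsWeakDifferential I θ w at hd
      have h1 : MemOrlicz I Φ₁ (r • θ) := hθ.smul r
      have h2 : IsWeakDifferential I (r • θ) (r • w) := hd.smul r
      exact ⟨r • θ, h1, h2⟩

/-- The `L_{Φ₁,Φ₂}`-cohomology `H^k_{Φ₁,Φ₂}(X) = Z^k_{Φ₂}(X) / B^k_{Φ₁,Φ₂}(X)`. -/
abbrev orliczCohomology (Φ₁ Φ₂ : NFunction) (k : ℕ) : Type _ :=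
  orliczCocycles I X Φ₂ k ⧸ (orliczCoboundaries I X Φ₁ Φ₂ k).submoduleOf (orliczCocycles I X Φ₂ k)

end Manifold

end

/-! If every closed form has a primitive, consider the graph of the weak differential: the pairs
`(θ, w)` with `θ ∈ L^{Φ₁}`, `w ∈ Z_{Φ₂}` and `dθ = w`, normed by `‖θ‖ + ‖w‖`. The projection `(θ, w)
↦ w` onto `Z_{Φ₂}` has norm at most `1` and is surjective by hypothesis. If both spaces are
complete, the open mapping theorem gives the constant `C`. The converse is immediate, since the
estimate already supplies primitives. In degree `0` the only primitive is the trivial one, and `C =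
0` works.

Completeness has two ingredients. The Orlicz spaces are complete by a Riesz–Fischer argument
(`MemOrlicz.exists_tendsto_gaugeNorm`): a rapidly Cauchy sequence converges almost everywhere, and
Fatou's lemma turns this into norm convergence. The weak differential is closed
(`IsWeakDifferential.of_tendsto`): superlinear growth gives `t ≤ Φ t + M`, so norm convergence
implies `L¹` convergence on compact sets, and both sides of the defining identity pass to the limit.
The latter uses that the volume is locally finite (`isLocallyFiniteMeasure_riemannianVolume`) and
that a test form and its differential are bounded (`DForm.IsTestForm.exists_modulus_le`).

Forms are not identified when they agree almost everywhere, so the gauge norms are only seminorms.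
The open mapping theorem is applied on separation quotients (`Seminorm.exists_preimage_le`) and
yields `dθ = w'` with `‖w' - w‖ = 0`; closedness of `d`, applied to constant sequences, then gives
`dθ = w`. -/

/-! ### The open mapping theorem for complete seminorms -/

open Filter in
/-- A version of Cauchy completeness for a seminorm. -/
def Seminorm.CompleteSeq {E : Type*} [AddCommGroup E] [Module ℝ E] (p : Seminorm ℝ E) : Prop :=
  ∀ u : ℕ → E, (∀ N n m : ℕ, N ≤ n → N ≤ m → p (u n - u m) < (1 / 4) ^ N) →
    ∃ x, Tendsto (fun n => p (u n - x)) atTop (𝓝 0)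

open Filter in
-- Convergence of rapidly Cauchy sequences already implies completeness, so the Banach open mapping
-- theorem applies to the map induced on separation quotients. Equality in the quotient of `F` only
-- means distance zero, hence the conclusion `q (f x - y) = 0` instead of `f x = y`.
theorem Seminorm.exists_preimage_le {E F : Type*} [AddCommGroup E] [Module ℝ E] [AddCommGroup F]
    [Module ℝ F] (p : Seminorm ℝ E) (q : Seminorm ℝ F) (hp : p.CompleteSeq) (hq : q.CompleteSeq)
    (f : E →ₗ[ℝ] F) (hf : ∀ x, q (f x) ≤ p x) (hsurj : Function.Surjective f) :
    ∃ C : ℝ, ∀ y, ∃ x, q (f x - y) = 0 ∧ p x ≤ C * q y := by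
  let _ : SeminormedAddCommGroup E := p.toAddGroupSeminorm.toSeminormedAddCommGroup
  let _ : SeminormedAddCommGroup F := q.toAddGroupSeminorm.toSeminormedAddCommGroup
  have hpn : ∀ x : E, ‖x‖ = p x := fun _ => rfl
  have hqn : ∀ x : F, ‖x‖ = q x := fun _ => rfl
  let _ : NormedSpace ℝ E := ⟨fun a b => by rw [hpn, hpn, map_smul_eq_mul]⟩
  let _ : NormedSpace ℝ F := ⟨fun a b => by rw [hqn, hqn, map_smul_eq_mul]⟩
  have hpos : ∀ N : ℕ, (0 : ENNReal) < ENNReal.ofReal ((1 / 4) ^ N) :=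
    fun N => ENNReal.ofReal_pos.2 (by positivity)
  have : CompleteSpace E := by
    refine EMetric.complete_of_convergent_controlled_sequences _ hpos fun u hu => ?_
    obtain ⟨x, hx⟩ := hp u fun N n m hn hm => by
      have := hu N n m hn hm
      rwa [edist_dist, ENNReal.ofReal_lt_ofReal_iff (by positivity), dist_eq_norm] at this
    exact ⟨x, tendsto_iff_norm_sub_tendsto_zero.2 hx⟩
  have : CompleteSpace F := by
    refine EMetric.complete_of_convergent_controlled_sequences _ hpos fun u hu => ?_
    obtain ⟨x, hx⟩ := hq u fun N n m hn hm => by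
      have := hu N n m hn hm
      rwa [edist_dist, ENNReal.ofReal_lt_ofReal_iff (by positivity), dist_eq_norm] at this
    exact ⟨x, tendsto_iff_norm_sub_tendsto_zero.2 hx⟩
  let g : E →L[ℝ] F := f.mkContinuous 1 fun x => by rw [one_mul]; exact hf x
  let mF : F →L[ℝ] SeparationQuotient F := SeparationQuotient.mkCLM ℝ F
  let G : SeparationQuotient E →L[ℝ] SeparationQuotient F :=
    SeparationQuotient.liftCLM (mF.comp g) fun x y h => (h.map (mF.comp g).continuous).eq
  have hG : Function.Surjective G := by
    intro y
    obtain ⟨y, rfl⟩ := SeparationQuotient.surjective_mk y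
    obtain ⟨x, rfl⟩ := hsurj y
    exact ⟨SeparationQuotient.mk x, rfl⟩
  obtain ⟨C, -, hC⟩ := G.exists_preimage_norm_le hG
  refine ⟨C, fun y => ?_⟩
  obtain ⟨x, hx, hxy⟩ := hC (SeparationQuotient.mk y)
  obtain ⟨x, rfl⟩ := SeparationQuotient.surjective_mk x
  refine ⟨x, ?_, hxy⟩
  have : Inseparable (f x) y := SeparationQuotient.mk_eq_mk.1 hx
  rw [Metric.inseparable_iff, dist_eq_norm] at this
  exact this

/-! ### Pointwise estimates for exterior forms -/

section

variable {V : Type*} [NormedAddCommGroup V] [InnerProductSpace ℝ V] [FiniteDimensional ℝ V]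

theorem abs_apply_stdOrthonormalBasis_le {k : ℕ} (a : V [⋀^Fin k]→ₗ[ℝ] ℝ)
    (v : Fin k → Fin (Module.finrank ℝ V)) :
    |a fun i => stdOrthonormalBasis ℝ V (v i)| ≤ Real.sqrt k.factorial * formNorm a := by
  rw [formNorm_eq_norm, ← mul_assoc, ← Real.sqrt_mul (by positivity),
    mul_inv_cancel₀ (by positivity), Real.sqrt_one, one_mul]
  exact PiLp.norm_apply_le (WithLp.toLp 2 fun v : Fin k → Fin (Module.finrank ℝ V) =>
      a fun i => stdOrthonormalBasis ℝ V (v i) : EuclideanSpace ℝ _) v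

/-- Multilinear expansion in an orthonormal basis: there are `(dim V) ^ k` terms, each a product of
coordinates of the `m i` with a component of `a`, and a component is at most `√(k!)` times the
modulus. -/
theorem abs_apply_le_formNorm {k : ℕ} (a : V [⋀^Fin k]→ₗ[ℝ] ℝ) (m : Fin k → V) :
    |a m| ≤ (Module.finrank ℝ V : ℝ) ^ k * Real.sqrt k.factorial * (∏ i, ‖m i‖) * formNorm a := by
  set e := stdOrthonormalBasis ℝ V with he
  have h1 : m = fun l => ∑ i, inner ℝ (e i) (m l) • e i := funext fun l => (e.sum_repr' (m l)).symm
  have h2 : a m = ∑ v : Fin k → Fin (Module.finrank ℝ V),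
      (∏ l, inner ℝ (e (v l)) (m l)) * a fun l => e (v l) := by
    conv_lhs => rw [h1]
    have := a.toMultilinearMap.map_sum (fun l i => inner ℝ (e i) (m l) • e i)
    simp only [AlternatingMap.coe_multilinearMap] at this
    rw [this]
    refine Finset.sum_congr rfl fun v _ => ?_
    have := a.toMultilinearMap.map_smul_univ (fun l => inner ℝ (e (v l)) (m l)) (fun l => e (v l))
    simpa using this
  have h3 : ∀ v : Fin k → Fin (Module.finrank ℝ V),
      |(∏ l, inner ℝ (e (v l)) (m l)) * a fun l => e (v l)| ≤
        (∏ i, ‖m i‖) * (Real.sqrt k.factorial * formNorm a) := by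
    intro v
    rw [abs_mul, Finset.abs_prod]
    refine mul_le_mul ?_ (abs_apply_stdOrthonormalBasis_le a v) (abs_nonneg _)
      (Finset.prod_nonneg fun _ _ => norm_nonneg _)
    refine Finset.prod_le_prod (fun _ _ => abs_nonneg _) fun l _ => ?_
    refine (abs_real_inner_le_norm _ _).trans ?_
    rw [e.norm_eq_one, one_mul]
  rw [h2]
  refine (Finset.abs_sum_le_sum_abs _ _).trans ((Finset.sum_le_sum fun v _ => h3 v).trans ?_)
  rw [Finset.sum_const, Finset.card_univ, Fintype.card_fun, Fintype.card_fin, Fintype.card_fin,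
    nsmul_eq_mul]
  push_cast
  exact le_of_eq (by ring)

/-- The Cauchy–Schwarz inequality for the vectors of components, with the factor `1 / k!` split into
two square roots. -/
theorem abs_formInner_le {k : ℕ} (a b : V [⋀^Fin k]→ₗ[ℝ] ℝ) :
    |formInner a b| ≤ formNorm a * formNorm b := by
  have h := abs_real_inner_le_norm
    (WithLp.toLp 2 fun v : Fin k → Fin (Module.finrank ℝ V) =>
      a fun i => stdOrthonormalBasis ℝ V (v i) : EuclideanSpace ℝ _)
    (WithLp.toLp 2 fun v : Fin k → Fin (Module.finrank ℝ V) =>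
      b fun i => stdOrthonormalBasis ℝ V (v i) : EuclideanSpace ℝ _)
  have h' := mul_le_mul_of_nonneg_left h (show (0 : ℝ) ≤ (k.factorial : ℝ)⁻¹ by positivity)
  rw [formNorm_eq_norm, formNorm_eq_norm, mul_mul_mul_comm, Real.mul_self_sqrt (by positivity)]
  refine le_trans (le_of_eq ?_) h'
  rw [formInner, abs_mul, abs_of_nonneg (show (0 : ℝ) ≤ (k.factorial : ℝ)⁻¹ by positivity)]
  simp only [PiLp.inner_apply]
  congr 2
  exact Finset.sum_congr rfl fun v _ => mul_comm _ _

theorem formNorm_le_of_forall {k : ℕ} (a : V [⋀^Fin k]→ₗ[ℝ] ℝ) {M : ℝ} (hM : 0 ≤ M)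
    (h : ∀ v : Fin k → Fin (Module.finrank ℝ V), |a fun i => stdOrthonormalBasis ℝ V (v i)| ≤ M) :
    formNorm a ≤ Real.sqrt ((Module.finrank ℝ V : ℝ) ^ k) * M := by
  rw [formNorm, ← Real.sqrt_sq hM, ← Real.sqrt_mul (by positivity)]
  refine Real.sqrt_le_sqrt ?_
  rw [formInner]
  calc _ ≤ 1 * ∑ v : Fin k → Fin (Module.finrank ℝ V), M ^ 2 := by
        refine mul_le_mul (inv_le_one_of_one_le₀ (by exact_mod_cast k.factorial_pos))
          (Finset.sum_le_sum fun v _ => ?_) (Finset.sum_nonneg fun v _ => mul_self_nonneg _)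
          zero_le_one
        rw [← sq, ← sq_abs]
        exact pow_le_pow_left₀ (abs_nonneg _) (h v) 2
    _ = _ := by
        rw [Finset.sum_const, Finset.card_univ, Fintype.card_fun, Fintype.card_fin,
          Fintype.card_fin, nsmul_eq_mul, one_mul]
        push_cast
        rfl

/-- The constant is chosen before the space `V`: it depends on the degrees and the dimension but not
on the scalar product. Hence one constant serves all tangent spaces at once. -/
theorem formNorm_wedge_le {j l n : ℕ} (h : j + l = n) (N : ℕ) : ∃ C : ℝ, 0 ≤ C ∧
    ∀ {V : Type*} [NormedAddCommGroup V] [InnerProductSpace ℝ V] [FiniteDimensional ℝ V],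
    Module.finrank ℝ V = N → ∀ (a : V [⋀^Fin j]→ₗ[ℝ] ℝ) (b : V [⋀^Fin l]→ₗ[ℝ] ℝ),
      formNorm (formWedge h a b) ≤ C * formNorm a * formNorm b := by
  classical
  refine ⟨Real.sqrt ((N : ℝ) ^ n) *
    (Fintype.card (Equiv.Perm.ModSumCongr (Fin j) (Fin l)) *
      (Real.sqrt j.factorial * Real.sqrt l.factorial)), by positivity, ?_⟩
  intro V _ _ _ hN a b
  have ha := formNorm_nonneg a
  have hb := formNorm_nonneg b
  refine (formNorm_le_of_forall (formWedge h a b)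
    (M := Fintype.card (Equiv.Perm.ModSumCongr (Fin j) (Fin l)) *
      ((Real.sqrt j.factorial * formNorm a) * (Real.sqrt l.factorial * formNorm b)))
    (by positivity) fun v => ?_).trans (le_of_eq ?_)
  · set w : Fin j ⊕ Fin l → V := fun i =>
      stdOrthonormalBasis ℝ V (v (finSumFinEquiv.trans (finCongr h) i)) with hw
    -- A component of the wedge product is a signed sum over shuffles of products of components of
    -- `a` and `b`, so the number of shuffles enters the constant.
    have h1 : (formWedge h a b fun i => stdOrthonormalBasis ℝ V (v i)) =
        LinearMap.mul' ℝ ℝ (a.domCoprod b w) := rfl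
    have h2 : a.domCoprod b w = ∑ σ : Equiv.Perm.ModSumCongr (Fin j) (Fin l),
        AlternatingMap.domCoprod.summand a b σ w := by
      rw [AlternatingMap.domCoprod_apply, sum_apply]
    rw [h1, h2, map_sum]
    refine (Finset.abs_sum_le_sum_abs _ _).trans ?_
    refine (Finset.sum_le_card_nsmul _ _ _ fun σ _ => ?_).trans (le_of_eq (nsmul_eq_mul _ _))
    induction σ using Quotient.inductionOn' with
    | h σ =>
      rw [AlternatingMap.domCoprod.summand_mk'']
      have h3 : |a fun i => w (σ (Sum.inl i))| * |b fun i => w (σ (Sum.inr i))| ≤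
          (Real.sqrt j.factorial * formNorm a) * (Real.sqrt l.factorial * formNorm b) :=
        mul_le_mul (abs_apply_stdOrthonormalBasis_le a _)
          (abs_apply_stdOrthonormalBasis_le b _) (abs_nonneg _) (by positivity)
      refine le_trans (le_of_eq ?_) h3
      rw [← abs_mul]
      rcases Int.units_eq_one_or (Equiv.Perm.sign σ) with hs | hs <;> simp [hs]
  · rw [hN]; ring

theorem continuous_formNorm_toAlternatingMap {k : ℕ} :
    Continuous fun a : V [⋀^Fin k]→L[ℝ] ℝ => formNorm a.toAlternatingMap := by
  simp only [formNorm_eq_norm]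
  refine continuous_const.mul (continuous_norm.comp ?_)
  refine (PiLp.continuous_toLp 2 _).comp (continuous_pi fun v => ?_)
  have : Continuous fun f : V [⋀^Fin k]→L[ℝ] ℝ =>
      f fun i => stdOrthonormalBasis ℝ V (v i) := by fun_prop
  exact this

theorem opNorm_le_formNorm {k : ℕ} (a : V [⋀^Fin k]→L[ℝ] ℝ) :
    ‖a‖ ≤ (Module.finrank ℝ V : ℝ) ^ k * Real.sqrt k.factorial * formNorm a.toAlternatingMap := by
  refine ContinuousAlternatingMap.opNorm_le_bound _
    (mul_nonneg (by positivity) (formNorm_nonneg _)) fun m => ?_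
  refine (abs_apply_le_formNorm a.toAlternatingMap m).trans (le_of_eq (by ring))

/-- Summable increments make the sequence Cauchy for the operator norm, which the modulus dominates;
the space of forms is complete. -/
theorem exists_tendsto_of_summable_formNorm {k : ℕ} (a : ℕ → V [⋀^Fin k]→L[ℝ] ℝ)
    (h : Summable fun i => formNorm (a (i + 1) - a i).toAlternatingMap) :
    ∃ b, Filter.Tendsto a Filter.atTop (𝓝 b) := by
  refine cauchySeq_tendsto_of_complete (cauchySeq_of_summable_dist
    (Summable.of_nonneg_of_le (fun _ => dist_nonneg) (fun i => ?_) (h.mul_left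
      ((Module.finrank ℝ V : ℝ) ^ k * Real.sqrt k.factorial))))
  rw [dist_comm, dist_eq_norm]
  exact opNorm_le_formNorm _

end

/-! ### Chart independence of the exterior differential; bounds for test forms -/

section

variable {n : ℕ} {H : Type*} [TopologicalSpace H]
  (I : ModelWithCorners ℝ (EuclideanSpace ℝ (Fin n)) H)
  {X : Type*} [TopologicalSpace X] [ChartedSpace H X] [IsManifold I ∞ X]

/-- The tangent space at `p` is modelled through the preferred chart at `p`, so the coordinate frame
of another chart is the derivative of a transition map. -/
theorem coordFrame_eq_tangentCoordChange {c p : X} (hp : p ∈ (chartAt H c).source)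
    (v : EuclideanSpace ℝ (Fin n)) : coordFrame I c p v = tangentCoordChange I c p p v := by
  exact DFunLike.congr_fun (TangentBundle.symmL_trivializationAt_eq_core (𝕜 := ℝ) (I := I)
    (E := EuclideanSpace ℝ (Fin n)) hp) v

theorem coordFrame_apply_tangentCoordChange {c c' p : X} (hc : p ∈ (chartAt H c).source)
    (hc' : p ∈ (chartAt H c').source) (v : EuclideanSpace ℝ (Fin n)) :
    coordFrame I c p (tangentCoordChange I c' c p v) = coordFrame I c' p v := by
  have h : tangentCoordChange I c p p (tangentCoordChange I c' c p v) =
      tangentCoordChange I c' p p v := by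
    refine tangentCoordChange_comp ?_
    simp only [extChartAt_source]
    exact ⟨⟨hc', hc⟩, mem_chart_source H p⟩
  exact (coordFrame_eq_tangentCoordChange I hc _).trans
    (h.trans (coordFrame_eq_tangentCoordChange I hc' v).symm)

theorem DForm.coord_comp_tangentCoordChange {k : ℕ} (w : DForm I X k) {c c' p : X}
    (hc : p ∈ (chartAt H c).source) (hc' : p ∈ (chartAt H c').source) :
    (w.coord I c p).compContinuousLinearMap (tangentCoordChange I c' c p) = w.coord I c' p := by
  ext v
  simp only [DForm.coord, ContinuousAlternatingMap.compContinuousLinearMap_apply]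
  congr 1
  funext i
  exact coordFrame_apply_tangentCoordChange I hc hc' (v i)

theorem DForm.pull_extChartAt {k : ℕ} (w : DForm I X k) {c p : X}
    (hp : p ∈ (chartAt H c).source) : w.pull I c (extChartAt I c p) = w.coord I c p := by
  rw [DForm.pull, (extChartAt I c).left_inv (by rwa [extChartAt_source])]

/-- The exterior differential does not depend on the chart in which it is computed. -/
theorem DForm.IsSmooth.coord_extDiff {m : ℕ} {u : DForm I X m} (hu : u.IsSmooth I) {c p : X}
    (hp : p ∈ (chartAt H c).source) :
    (u.extDiff I).coord I c p =
      extDerivWithin (u.pull I c) (Set.range I) (extChartAt I c p) := by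
  have hps : p ∈ (extChartAt I c).source := by rwa [extChartAt_source]
  have hpp : p ∈ (extChartAt I p).source := mem_extChartAt_source p
  set φ := extChartAt I p ∘ (extChartAt I c).symm with hφ
  have hφp : φ (extChartAt I c p) = extChartAt I p p := by
    rw [hφ, Function.comp_apply, (extChartAt I c).left_inv hps]
  have hmem : extChartAt I c p ∈ ((extChartAt I c).symm ≫ extChartAt I p).source := by
    rw [PartialEquiv.trans_source'', PartialEquiv.symm_symm, PartialEquiv.symm_target]
    exact Set.mem_image_of_mem _ ⟨hps, hpp⟩
  have hrange : extChartAt I c p ∈ Set.range I :=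
    extChartAt_target_subset_range c ((extChartAt I c).map_source hps)
  have hdiff : DifferentiableWithinAt ℝ (u.pull I p) (Set.range I) (φ (extChartAt I c p)) := by
    rw [hφp]
    have := (hu p _ (mem_extChartAt_target p)).differentiableWithinAt (by simp)
    -- Near a point of the chart target, being in the target and being in `Set.range I` are the
    -- same; this also covers boundary points.
    exact this.mono_of_mem_nhdsWithin (extChartAt_target_mem_nhdsWithin p)
  -- Naturality: `d` commutes with pullback along the transition map `φ` from the chart at `c` to
  -- the chart at `p`.
  have hpb := extDerivWithin_pullback (r := ∞) (x := extChartAt I c p) hdiff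
    (contDiffWithinAt_ext_coord_change p c hmem)
    (by rw [minSmoothness_of_isRCLikeNormedField]; exact WithTop.coe_le_coe.2 le_top) I.uniqueDiffOn
    (I.range_subset_closure_interior hrange) hrange
    (fun y _ => Set.mem_range_self _)
  -- Where both charts are defined, the expression of `u` in the chart at `c` is the pullback under
  -- `φ` of its expression in the chart at `p`.
  have hev : (fun y => (u.pull I p (φ y)).compContinuousLinearMap
      (fderivWithin ℝ φ (Set.range I) y)) =ᶠ[𝓝[Set.range I] (extChartAt I c p)] u.pull I c := by
    have h1 : (extChartAt I c).target ∩ (extChartAt I c).symm ⁻¹' (extChartAt I p).source ∈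
        𝓝[Set.range I] (extChartAt I c p) := by
      refine Filter.inter_mem (extChartAt_target_mem_nhdsWithin' hps) ?_
      have := (continuousAt_extChartAt_symm' hps).preimage_mem_nhds
        (t := (extChartAt I p).source) (by
          rw [(extChartAt I c).left_inv hps]
          exact (isOpen_extChartAt_source p).mem_nhds hpp)
      exact mem_nhdsWithin_of_mem_nhds this
    filter_upwards [h1] with y hy
    have hq1 : (extChartAt I c).symm y ∈ (extChartAt I c).source := (extChartAt I c).map_target hy.1
    have hq2 : (extChartAt I c).symm y ∈ (extChartAt I p).source := hy.2
    have e1 : fderivWithin ℝ φ (Set.range I) y =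
        tangentCoordChange I c p ((extChartAt I c).symm y) := by
      rw [tangentCoordChange_def, (extChartAt I c).right_inv hy.1]
    rw [e1]
    rw [extChartAt_source] at hq1 hq2
    rw [hφ, Function.comp_apply, DForm.pull_extChartAt I u hq2,
      DForm.coord_comp_tangentCoordChange I u hq2 hq1]
    rfl
  rw [← hev.extDerivWithin_eq_of_mem hrange, hpb, hφp]
  have e2 : fderivWithin ℝ φ (Set.range I) (extChartAt I c p) = tangentCoordChange I c p p := rfl
  rw [e2]
  ext v
  simp only [DForm.coord, DForm.extDiff, ContinuousAlternatingMap.compContinuousLinearMap_apply]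
  congr 1
  funext i
  rw [Function.comp_apply, Function.comp_apply, Function.comp_apply,
    coordFrame_eq_tangentCoordChange I hp,
    TangentBundle.continuousLinearMapAt_trivializationAt_eq_core (mem_chart_source H p)]
  exact tangentCoordChange_self (by exact hpp)

theorem DForm.IsSmooth.continuousOn_coord {m : ℕ} {u : DForm I X m} (hu : u.IsSmooth I) (c : X) :
    ContinuousOn (u.coord I c) (chartAt H c).source := by
  have h := (hu c).continuousOn.comp (continuousOn_extChartAt c)
    (fun p hp => (extChartAt I c).map_source hp)
  rw [extChartAt_source] at h
  exact h.congr fun p hp => (DForm.pull_extChartAt I u hp).symm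

/-- `DForm.extDiff` uses a different chart at each point, so continuity is not visible from its
definition. Chart independence allows a single chart to be used throughout its domain. -/
theorem DForm.IsSmooth.continuousOn_coord_extDiff {m : ℕ} {u : DForm I X m} (hu : u.IsSmooth I)
    (c : X) : ContinuousOn ((u.extDiff I).coord I c) (chartAt H c).source := by
  have h1 : ContinuousOn (extDerivWithin (u.pull I c) (Set.range I)) (extChartAt I c).target := by
    have h2 : ContinuousOn (fderivWithin ℝ (u.pull I c) (extChartAt I c).target)
        (extChartAt I c).target :=
      (hu c).continuousOn_fderivWithin (uniqueDiffOn_extChartAt_target c) (by simp)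
    have h3 : ContinuousOn (fderivWithin ℝ (u.pull I c) (Set.range I)) (extChartAt I c).target :=
      h2.congr fun y hy => by
        exact fderivWithin_congr_set (extChartAt_target_eventuallyEq_of_mem hy).symm
    exact (ContinuousAlternatingMap.alternatizeUncurryFinCLM ℝ _ _).continuous.comp_continuousOn h3
  have h := h1.comp (continuousOn_extChartAt c) (fun p hp => (extChartAt I c).map_source hp)
  rw [extChartAt_source] at h
  exact h.congr fun p hp => hu.coord_extDiff I hp

theorem DForm.extDiff_eq_zero_of_notMem_closure {m : ℕ} {u : DForm I X m} {x : X}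
    (hx : x ∉ closure {x | u x ≠ 0}) : u.extDiff I x = 0 := by
  have h0 : ∀ᶠ p in 𝓝 x, u p = 0 := by
    filter_upwards [isClosed_closure.isOpen_compl.mem_nhds hx] with p hp
    by_contra h
    exact hp (subset_closure h)
  have h1 : u.pull I x =ᶠ[𝓝[Set.range I] (extChartAt I x x)] fun _ => 0 := by
    have h2 := (continuousAt_extChartAt_symm (I := I) x).eventually (by
      rw [extChartAt_to_inv]; exact h0)
    filter_upwards [mem_nhdsWithin_of_mem_nhds h2] with y hy
    rw [DForm.pull, DForm.coord, hy]
    rfl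
  have h3 : extDerivWithin (u.pull I x) (Set.range I) (extChartAt I x x) = 0 := by
    rw [h1.extDerivWithin_eq_of_mem (extChartAt_target_subset_range x (mem_extChartAt_target x))]
    ext v
    simp [extDerivWithin, ContinuousAlternatingMap.alternatizeUncurryFin_apply]
  rw [DForm.extDiff, h3]
  rfl

variable [RiemannianBundle (fun x : X => TangentSpace I x)]
  [IsContMDiffRiemannianBundle I ∞ (EuclideanSpace ℝ (Fin n)) (fun x : X => TangentSpace I x)]

theorem metricMatrix_det_pos {c p : X} (hp : p ∈ (chartAt H c).source) :
    0 < (metricMatrix I c p).det := by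
  have : metricMatrix I c p = Matrix.gram ℝ (coordBasis I hp) := by
    ext i j
    simp [metricMatrix, Matrix.gram, coordBasis_apply]
  rw [this]
  exact (Matrix.posDef_gram_of_linearIndependent (coordBasis I hp).linearIndependent).det_pos

/-- By `formInner_eq_gram` the squared modulus is, in a chart, a polynomial in the coefficients of
the form and of the inverse metric matrix; the inverse is continuous because the determinant does
not vanish. -/
theorem DForm.continuous_modulus {k : ℕ} {w : DForm I X k}
    (hw : ∀ c, ContinuousOn (w.coord I c) (chartAt H c).source) : Continuous (w.modulus I) := by
  refine continuous_iff_continuousAt.2 fun c => ?_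
  refine ContinuousOn.continuousAt ?_ (chart_source_mem_nhds H c)
  have hG : ContinuousOn (fun p => (metricMatrix I c p)) (chartAt H c).source :=
    continuousOn_metricMatrix I c
  have hGi : ∀ i j, ContinuousOn (fun p => (metricMatrix I c p)⁻¹ i j) (chartAt H c).source := by
    intro i j
    have h1 : ContinuousOn (fun p => (metricMatrix I c p).det) (chartAt H c).source :=
      Continuous.comp_continuousOn (continuous_id.matrix_det) hG
    have h2 : ContinuousOn (fun p => (metricMatrix I c p).adjugate i j) (chartAt H c).source :=
      Continuous.comp_continuousOn
        (g := fun A : Matrix (Fin n) (Fin n) ℝ => A.adjugate i j)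
        ((continuous_id.matrix_adjugate).matrix_elem i j) hG
    simp only [Matrix.inv_def, Ring.inverse_eq_inv', Matrix.smul_apply, smul_eq_mul]
    exact (h1.inv₀ fun p hp => (metricMatrix_det_pos I hp).ne').mul h2
  have hc : ∀ v : Fin k → Fin n, ContinuousOn
      (fun p => w.coord I c p fun l => EuclideanSpace.single (v l) 1) (chartAt H c).source := by
    intro v
    have hcont : Continuous fun f : EuclideanSpace ℝ (Fin n) [⋀^Fin k]→L[ℝ] ℝ =>
        f fun l => EuclideanSpace.single (v l) 1 := by fun_prop
    exact hcont.comp_continuousOn (hw c)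
  have key : ContinuousOn (fun p => Real.sqrt (((k.factorial : ℝ))⁻¹ *
      ∑ v : Fin k → Fin n, ∑ v' : Fin k → Fin n,
        (∏ l, (metricMatrix I c p)⁻¹ (v l) (v' l)) *
        ((w.coord I c p fun l => EuclideanSpace.single (v l) 1) *
          (w.coord I c p fun l => EuclideanSpace.single (v' l) 1)))) (chartAt H c).source := by
    refine ContinuousOn.sqrt (continuousOn_const.mul ?_)
    refine continuousOn_finsetSum _ fun v _ => continuousOn_finsetSum _ fun v' _ => ?_
    exact (continuousOn_finsetProd _ fun l _ => hGi _ _).mul ((hc v).mul (hc v'))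
  refine key.congr fun p hp => ?_
  rw [DForm.modulus, formNorm, formInner_eq_gram (coordBasis I hp)]
  simp only [coordBasis_apply]
  rfl

/-- The modulus of a test form and that of its differential are bounded. -/
theorem DForm.IsTestForm.exists_modulus_le {m : ℕ} {u : DForm I X m} {U : Set X}
    (hu : u.IsTestForm I U) : ∃ C : ℝ, 0 ≤ C ∧ (∀ x, u.modulus I x ≤ C) ∧
      ∀ x, (u.extDiff I).modulus I x ≤ C := by
  obtain ⟨hs, hK, -⟩ := hu
  obtain ⟨C₁, h₁⟩ := hK.exists_bound_of_continuousOn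
    (DForm.continuous_modulus I hs.continuousOn_coord).continuousOn
  obtain ⟨C₂, h₂⟩ := hK.exists_bound_of_continuousOn
    (DForm.continuous_modulus I hs.continuousOn_coord_extDiff).continuousOn
  refine ⟨max 0 (max C₁ C₂), le_max_left _ _, fun x => ?_, fun x => ?_⟩
  · by_cases hx : x ∈ closure {x | u x ≠ 0}
    · exact (le_abs_self _).trans ((h₁ x hx).trans (by simp))
    · have : u x = 0 := by
        by_contra h
        exact hx (subset_closure h)
      have h0 : u.modulus I x = (0 : DForm I X m).modulus I x := by
        rw [DForm.modulus, DForm.modulus, this]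
        rfl
      rw [h0, DForm.modulus_zero]
      exact le_max_left _ _
  · by_cases hx : x ∈ closure {x | u x ≠ 0}
    · exact (le_abs_self _).trans ((h₂ x hx).trans (by simp))
    · have h0 : (u.extDiff I).modulus I x = (0 : DForm I X (m + 1)).modulus I x := by
        rw [DForm.modulus, DForm.modulus, DForm.extDiff_eq_zero_of_notMem_closure I hx]
        rfl
      rw [h0, DForm.modulus_zero]
      exact le_max_left _ _

end

/-! ### Local finiteness of the Riemannian volume -/

section

variable {n : ℕ} {H : Type*} [TopologicalSpace H]
  (I : ModelWithCorners ℝ (EuclideanSpace ℝ (Fin n)) H)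
  {X : Type*} [TopologicalSpace X] [ChartedSpace H X] [IsManifold I ∞ X]
  [RiemannianBundle (fun x : X => TangentSpace I x)]
  [IsContMDiffRiemannianBundle I ∞ (EuclideanSpace ℝ (Fin n)) (fun x : X => TangentSpace I x)]

/-- The Gram matrix transforms as `Aᵀ G A`, with `A` the matrix of the coordinate change. -/
theorem metricMatrix_det_eq {c c' p : X} (hc : p ∈ (chartAt H c).source)
    (hc' : p ∈ (chartAt H c').source) :
    (metricMatrix I c' p).det =
      (tangentCoordChange I c' c p).det ^ 2 * (metricMatrix I c p).det := by
  set b := (EuclideanSpace.basisFun (Fin n) ℝ).toBasis with hb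
  set T := tangentCoordChange I c' c p with hT
  set A : Matrix (Fin n) (Fin n) ℝ := LinearMap.toMatrix b b T.toLinearMap with hA
  have hbi : ∀ i, b i = EuclideanSpace.single i (1 : ℝ) := fun i => by simp [hb]
  have h1 : ∀ i, coordFrame I c' p (EuclideanSpace.single i 1) =
      ∑ a, A a i • coordFrame I c p (EuclideanSpace.single a 1) := by
    intro i
    rw [← coordFrame_apply_tangentCoordChange I hc hc' (EuclideanSpace.single i 1), ← hT]
    have h2 : T (EuclideanSpace.single i 1) = ∑ a, A a i • EuclideanSpace.single a (1 : ℝ) := by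
      have := (b.sum_repr (T (b i))).symm
      simpa [hbi, hA, LinearMap.toMatrix_apply] using this
    conv_lhs => rw [h2]
    rw [map_sum]
    exact Finset.sum_congr rfl fun a _ => map_smul _ _ _
  have h3 : metricMatrix I c' p = A.transpose * metricMatrix I c p * A := by
    ext i j
    simp only [metricMatrix, Matrix.of_apply, h1, Matrix.mul_apply, Matrix.transpose_apply,
      sum_inner, inner_sum, real_inner_smul_left, real_inner_smul_right, Finset.sum_mul]
    exact Finset.sum_congr rfl fun a _ => Finset.sum_congr rfl fun a' _ => by ring
  have h4 : A.det = T.det := LinearMap.det_toMatrix b T.toLinearMap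
  rw [h3, Matrix.det_mul, Matrix.det_mul, Matrix.det_transpose, h4]
  ring

/-- The density of the Riemannian volume in the chart around `c`. -/
noncomputable def volumeDensity (c : X) (y : EuclideanSpace ℝ (Fin n)) : ENNReal :=
  ENNReal.ofReal (Real.sqrt (metricMatrix I c ((extChartAt I c).symm y)).det)

theorem volumeDensity_eq {c c' p : X} (hc : p ∈ (chartAt H c).source)
    (hc' : p ∈ (chartAt H c').source) :
    volumeDensity I c' (extChartAt I c' p) =
      ENNReal.ofReal |(tangentCoordChange I c' c p).det| *
        volumeDensity I c (extChartAt I c p) := by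
  rw [volumeDensity, volumeDensity, (extChartAt I c).left_inv (by rwa [extChartAt_source]),
    (extChartAt I c').left_inv (by rwa [extChartAt_source]), metricMatrix_det_eq I hc hc',
    Real.sqrt_mul (sq_nonneg _), Real.sqrt_sq_eq_abs, ENNReal.ofReal_mul (abs_nonneg _)]

theorem continuousOn_volumeDensity (c : X) :
    ContinuousOn (volumeDensity I c) (extChartAt I c).target := by
  refine ENNReal.continuous_ofReal.comp_continuousOn (ContinuousOn.sqrt ?_)
  refine Continuous.comp_continuousOn (continuous_id.matrix_det) ?_
  refine (continuousOn_metricMatrix I c).comp (continuousOn_extChartAt_symm c) fun y hy => ?_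
  rw [← extChartAt_source I]
  exact (extChartAt I c).map_target hy

theorem measurableSet_extChartAt_target (c : X) : MeasurableSet (extChartAt I c).target := by
  rw [extChartAt_target]
  exact ((chartAt H c).open_target.preimage I.continuous_symm).measurableSet.inter
    I.isClosed_range.measurableSet

variable [MeasurableSpace X] [BorelSpace X]

/-- The Riemannian volume of the domain of the chart around `c`. -/
noncomputable def chartVolume (c : X) : MeasureTheory.Measure X :=
  ((MeasureTheory.volume.restrict (extChartAt I c).target).withDensity
    (volumeDensity I c)).map (extChartAt I c).symm

theorem chartVolume_apply (c : X) {S : Set X} (hS : MeasurableSet S) :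
    chartVolume I c S = ∫⁻ y in (extChartAt I c).target ∩ (extChartAt I c).symm ⁻¹' S,
      volumeDensity I c y := by
  have hT := measurableSet_extChartAt_target I c
  have h1 : AEMeasurable (extChartAt I c).symm
      (MeasureTheory.volume.restrict (extChartAt I c).target) :=
    (continuousOn_extChartAt_symm c).aemeasurable hT
  have h2 : AEMeasurable (extChartAt I c).symm
      ((MeasureTheory.volume.restrict (extChartAt I c).target).withDensity (volumeDensity I c)) :=
    h1.mono_ac (MeasureTheory.withDensity_absolutelyContinuous _ _)
  have h3 : MeasureTheory.NullMeasurableSet ((extChartAt I c).symm ⁻¹' S)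
      (MeasureTheory.volume.restrict (extChartAt I c).target) := h1.nullMeasurableSet_preimage hS
  rw [chartVolume, MeasureTheory.Measure.map_apply_of_aemeasurable h2 hS,
    MeasureTheory.withDensity_apply₀ _ h3, MeasureTheory.Measure.restrict_restrict₀ h3,
    Set.inter_comm]

theorem measurableSet_target_inter_preimage (c : X) {S : Set X} (hS : MeasurableSet S) :
    MeasurableSet ((extChartAt I c).target ∩ (extChartAt I c).symm ⁻¹' S) := by
  classical
  have hT := measurableSet_extChartAt_target I c
  -- The inverse chart is controlled only on its target. Extending it by a constant gives a globally
  -- measurable map with the same trace on the target.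
  have h1 := (continuousOn_extChartAt_symm (I := I) c).measurable_piecewise
    (g := fun _ => c) continuousOn_const hT
  have h2 : (extChartAt I c).target ∩ (extChartAt I c).symm ⁻¹' S =
      (extChartAt I c).target ∩
        ((extChartAt I c).target.piecewise (extChartAt I c).symm fun _ => c) ⁻¹' S := by
    ext y
    refine and_congr_right fun hy => ?_
    rw [Set.mem_preimage, Set.mem_preimage, Set.piecewise_eq_of_mem _ _ _ hy]
  rw [h2]
  exact hT.inter (by convert h1 hS)

/-- Change of variables along the transition map: the Jacobian cancels against the transformation of
the densities. Only an inequality holds in general, since the chart at `c'` may miss part of `S`. -/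
theorem chartVolume_le_of_subset {c c' : X} {S : Set X} (hS : MeasurableSet S)
    (hSc : S ⊆ (chartAt H c).source) : chartVolume I c' S ≤ chartVolume I c S := by
  rw [chartVolume_apply I c hS, chartVolume_apply I c' hS]
  set T' := (extChartAt I c').target ∩ (extChartAt I c').symm ⁻¹' S with hT'
  have hT'm : MeasurableSet T' := measurableSet_target_inter_preimage I c' hS
  set φ := extChartAt I c ∘ (extChartAt I c').symm with hφ
  have hsrc : ∀ y ∈ T', (extChartAt I c').symm y ∈ (extChartAt I c').source ∩
      (extChartAt I c).source := fun y hy =>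
    ⟨(extChartAt I c').map_target hy.1, by rw [extChartAt_source]; exact hSc hy.2⟩
  have hinj : Set.InjOn φ T' := by
    intro y hy z hz h
    have h1 := (extChartAt I c).injOn (hsrc y hy).2 (hsrc z hz).2 h
    exact (extChartAt I c').symm.injOn hy.1 hz.1 h1
  have hder : ∀ y ∈ T', HasFDerivWithinAt φ
      (tangentCoordChange I c' c ((extChartAt I c').symm y)) T' y := by
    intro y hy
    have := hasFDerivWithinAt_tangentCoordChange (I := I) (hsrc y hy)
    rw [(extChartAt I c').right_inv hy.1] at this
    exact this.mono fun z hz => extChartAt_target_subset_range c' hz.1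
  have himg : φ '' T' ⊆ (extChartAt I c).target ∩ (extChartAt I c).symm ⁻¹' S := by
    rintro _ ⟨y, hy, rfl⟩
    refine ⟨(extChartAt I c).map_source (hsrc y hy).2, ?_⟩
    rw [Set.mem_preimage, hφ, Function.comp_apply, (extChartAt I c).left_inv (hsrc y hy).2]
    exact hy.2
  refine le_trans (le_of_eq ?_) (MeasureTheory.lintegral_mono_set himg)
  rw [MeasureTheory.lintegral_image_eq_lintegral_abs_det_fderiv_mul _ hT'm hder hinj]
  refine MeasureTheory.setLIntegral_congr_fun hT'm fun y hy => ?_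
  have h := hsrc y hy
  simp only [extChartAt_source] at h
  have := volumeDensity_eq I h.2 h.1
  rw [(extChartAt I c').right_inv hy.1] at this
  exact this

/-- A supremum of measures is bounded by exhibiting an upper bound. On the domain of the chart at
`c` its own measure dominates those of all other charts; off the domain the bound is the largest
measure, which costs nothing for subsets of the domain. -/
theorem riemannianVolume_le (c : X) : riemannianVolume I X ≤
    chartVolume I c + (⊤ : MeasureTheory.Measure X).restrict (chartAt H c).sourceᶜ := by
  refine iSup_le fun c' => ?_
  have hs : MeasurableSet (chartAt H c).source := (chartAt H c).open_source.measurableSet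
  have h1 : chartVolume I c' ≤
      chartVolume I c + (⊤ : MeasureTheory.Measure X).restrict (chartAt H c).sourceᶜ := by
    rw [← MeasureTheory.Measure.restrict_add_restrict_compl (μ := chartVolume I c') hs]
    refine add_le_add (MeasureTheory.Measure.le_iff.2 fun S hS => ?_)
      (MeasureTheory.Measure.restrict_mono le_rfl le_top)
    rw [MeasureTheory.Measure.restrict_apply hS]
    exact (chartVolume_le_of_subset I (hS.inter hs) Set.inter_subset_right).trans
      (MeasureTheory.measure_mono Set.inter_subset_left)
  exact h1

/-- A compact neighbourhood inside a chart has compact image, on which the continuous density is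
bounded. -/
theorem isLocallyFiniteMeasure_riemannianVolume [T2Space X] :
    MeasureTheory.IsLocallyFiniteMeasure (riemannianVolume I X) := by
  have : LocallyCompactSpace X := Manifold.locallyCompact_of_finiteDimensional I
  refine ⟨fun c => ?_⟩
  obtain ⟨K, hKc, hKs, hK⟩ := exists_compact_subset (chartAt H c).open_source (mem_chart_source H c)
  refine ⟨K, mem_interior_iff_mem_nhds.1 hKs, ?_⟩
  have hKm := hKc.measurableSet
  refine (riemannianVolume_le I c K).trans_lt ?_
  rw [MeasureTheory.Measure.add_apply, MeasureTheory.Measure.restrict_apply hKm,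
    ← Set.sdiff_eq, Set.sdiff_eq_empty.2 hK, MeasureTheory.measure_empty, add_zero,
    chartVolume_apply I c hKm]
  have hKs' : K ⊆ (extChartAt I c).source := by rwa [extChartAt_source]
  have hL : IsCompact (extChartAt I c '' K) :=
    hKc.image_of_continuousOn ((continuousOn_extChartAt c).mono hKs')
  have hLt : extChartAt I c '' K ⊆ (extChartAt I c).target := by
    rintro _ ⟨p, hp, rfl⟩
    exact (extChartAt I c).map_source (hKs' hp)
  have heq : (extChartAt I c).target ∩ (extChartAt I c).symm ⁻¹' K ⊆ extChartAt I c '' K := by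
    rintro y ⟨hy, hy'⟩
    exact ⟨_, hy', (extChartAt I c).right_inv hy⟩
  refine (MeasureTheory.lintegral_mono_set heq).trans_lt ?_
  obtain ⟨M, hM⟩ : ∃ M : ENNReal, M < ⊤ ∧ ∀ y ∈ extChartAt I c '' K, volumeDensity I c y ≤ M := by
    rcases (extChartAt I c '' K).eq_empty_or_nonempty with h | h
    · exact ⟨0, by simp, fun y hy => absurd hy (by rw [h]; exact Set.notMem_empty y)⟩
    · obtain ⟨z, hz, hz'⟩ := hL.exists_isMaxOn h ((continuousOn_volumeDensity I c).mono hLt)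
      exact ⟨volumeDensity I c z, ENNReal.ofReal_lt_top, fun y hy => hz' hy⟩
  refine (MeasureTheory.setLIntegral_mono' hL.measurableSet hM.2).trans_lt ?_
  rw [MeasureTheory.setLIntegral_const]
  exact ENNReal.mul_lt_top hM.1 hL.measure_lt_top

end

/-! ### The gauge norm is a seminorm and controls local `L¹` norms -/

namespace NFunction

theorem mul_le (Φ : NFunction) {t : ℝ} (ht : 0 ≤ t) (ht1 : t ≤ 1) (x : ℝ) :
    Φ (t * x) ≤ t * Φ x := by
  have h := Φ.convex.2 (Set.mem_univ x) (Set.mem_univ 0) ht (sub_nonneg.2 ht1) (by ring)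
  simpa [Φ.map_zero] using h

/-- Since `Φ t / t → ∞`, one has `t ≤ Φ t` beyond some threshold `M`; below it, `t ≤ M`. -/
theorem exists_le_add (Φ : NFunction) : ∃ M : ℝ, 0 ≤ M ∧ ∀ t, 0 ≤ t → t ≤ Φ t + M := by
  obtain ⟨M, hM⟩ := Filter.eventually_atTop.1 (Φ.tendsto_atTop.eventually_ge_atTop 1)
  refine ⟨max M 0, le_max_right _ _, fun t ht => ?_⟩
  rcases le_or_gt t (max M 0) with h | h
  · linarith [Φ.nonneg t]
  · have h0 : 0 < t := (le_max_right _ _).trans_lt h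
    have := hM t ((le_max_left _ _).trans h.le)
    rw [le_div_iff₀ h0] at this
    linarith [le_max_right M 0]

end NFunction

section

variable {n : ℕ} {H : Type*} [TopologicalSpace H]
  {I : ModelWithCorners ℝ (EuclideanSpace ℝ (Fin n)) H}
  {X : Type*} [TopologicalSpace X] [ChartedSpace H X] [IsManifold I ∞ X]
  [RiemannianBundle (fun x : X => TangentSpace I x)]
  [MeasurableSpace X] [BorelSpace X] {Φ : NFunction} {k : ℕ}

theorem rho_smul_mono (w : DForm I X k) {a b : ℝ} (ha : 0 ≤ a) (hab : a ≤ b) :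
    rho I Φ (a • w) ≤ rho I Φ (b • w) := by
  refine MeasureTheory.lintegral_mono fun x => ENNReal.ofReal_le_ofReal ?_
  rw [DForm.modulus_smul, DForm.modulus_smul, abs_of_nonneg ha, abs_of_nonneg (ha.trans hab)]
  exact Φ.mono (mul_nonneg ha (DForm.modulus_nonneg I w x))
    (mul_le_mul_of_nonneg_right hab (DForm.modulus_nonneg I w x))

theorem rho_smul_le (w : DForm I X k) {t : ℝ} (ht : 0 ≤ t) (ht1 : t ≤ 1) :
    rho I Φ (t • w) ≤ ENNReal.ofReal t * rho I Φ w := by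
  rw [rho, rho, ← MeasureTheory.lintegral_const_mul' _ _ ENNReal.ofReal_ne_top]
  refine MeasureTheory.lintegral_mono fun x => ?_
  rw [← ENNReal.ofReal_mul ht, DForm.modulus_smul, abs_of_nonneg ht]
  exact ENNReal.ofReal_le_ofReal (Φ.mul_le ht ht1 _)

/-- This makes the set in `gaugeNorm` nonempty, so that its infimum is not a default value. With `M
= ρ(α w)`, convexity gives `ρ(α w / (M + 1)) ≤ M / (M + 1)`. -/
theorem MemOrlicz.exists_rho_le_one {w : DForm I X k} (hw : MemOrlicz I Φ w) :
    ∃ K : ℝ, 0 < K ∧ rho I Φ (K⁻¹ • w) ≤ 1 := by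
  obtain ⟨-, α, hα, h⟩ := hw
  set M := (rho I Φ (α • w)).toReal with hM
  have hM0 : 0 ≤ M := ENNReal.toReal_nonneg
  refine ⟨(M + 1) / α, by positivity, ?_⟩
  have h1 : ((M + 1) / α)⁻¹ • w = (M + 1)⁻¹ • α • w := by
    rw [smul_smul, inv_div, div_eq_inv_mul]
  rw [h1]
  refine (rho_smul_le _ (by positivity) (inv_le_one_of_one_le₀ (by linarith))).trans ?_
  rw [← ENNReal.ofReal_toReal h.ne, ← ENNReal.ofReal_mul (by positivity), ← hM]
  refine ENNReal.ofReal_le_one.2 ?_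
  rw [inv_mul_le_one₀ (by linarith)]
  linarith

theorem gaugeNorm_nonneg (w : DForm I X k) : 0 ≤ gaugeNorm I Φ w :=
  Real.sInf_nonneg fun _ h => h.1.le

theorem gaugeNorm_le {w : DForm I X k} {K : ℝ} (hK : 0 < K) (h : rho I Φ (K⁻¹ • w) ≤ 1) :
    gaugeNorm I Φ w ≤ K :=
  csInf_le ⟨0, fun _ h => h.1.le⟩ ⟨hK, h⟩

theorem MemOrlicz.rho_le_one {w : DForm I X k} (hw : MemOrlicz I Φ w) {K : ℝ}
    (h : gaugeNorm I Φ w < K) : rho I Φ (K⁻¹ • w) ≤ 1 := by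
  obtain ⟨L, ⟨hL0, hL⟩, hLK⟩ := exists_lt_of_csInf_lt hw.exists_rho_le_one h
  exact (rho_smul_mono w (inv_nonneg.2 (hL0.trans hLK).le) (inv_anti₀ hL0 hLK.le)).trans hL

theorem rho_congr {j : ℕ} {w : DForm I X k} {w' : DForm I X j}
    (h : ∀ x, w.modulus I x = w'.modulus I x) : rho I Φ w = rho I Φ w' := by
  simp only [rho, h]

theorem gaugeNorm_zero : gaugeNorm I Φ (0 : DForm I X k) = 0 := by
  refine le_antisymm (le_of_forall_pos_le_add fun ε hε => ?_) (gaugeNorm_nonneg _)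
  rw [zero_add]
  refine gaugeNorm_le hε ?_
  simp [rho, DForm.modulus_zero, Φ.map_zero]

theorem MemOrlicz.gaugeNorm_smul_le {w : DForm I X k} (hw : MemOrlicz I Φ w) (r : ℝ) :
    gaugeNorm I Φ (r • w) ≤ |r| * gaugeNorm I Φ w := by
  rcases eq_or_ne r 0 with rfl | hr
  · rw [zero_smul, gaugeNorm_zero, abs_zero, zero_mul]
  have hr' : 0 < |r| := abs_pos.2 hr
  refine le_of_forall_pos_le_add fun ε hε => ?_
  have hK : gaugeNorm I Φ w < gaugeNorm I Φ w + ε / |r| := by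
    have : 0 < ε / |r| := by positivity
    linarith
  have h0 : 0 < gaugeNorm I Φ w + ε / |r| := (gaugeNorm_nonneg w).trans_lt hK
  have h := hw.rho_le_one hK
  have e : |r| * gaugeNorm I Φ w + ε = |r| * (gaugeNorm I Φ w + ε / |r|) := by field_simp
  rw [e]
  refine gaugeNorm_le (by positivity) (le_trans (le_of_eq (rho_congr fun x => ?_)) h)
  simp only [DForm.modulus_smul, abs_inv, abs_mul, abs_abs, mul_inv]
  field_simp

theorem MemOrlicz.gaugeNorm_smul {w : DForm I X k} (hw : MemOrlicz I Φ w) (r : ℝ) :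
    gaugeNorm I Φ (r • w) = |r| * gaugeNorm I Φ w := by
  refine le_antisymm (hw.gaugeNorm_smul_le r) ?_
  rcases eq_or_ne r 0 with rfl | hr
  · rw [zero_smul, gaugeNorm_zero, abs_zero, zero_mul]
  have h := (hw.smul r).gaugeNorm_smul_le r⁻¹
  rw [inv_smul_smul₀ hr, abs_inv] at h
  have hr' : 0 < |r| := abs_pos.2 hr
  calc |r| * gaugeNorm I Φ w ≤ |r| * (|r|⁻¹ * gaugeNorm I Φ (r • w)) :=
        mul_le_mul_of_nonneg_left h hr'.le
    _ = gaugeNorm I Φ (r • w) := by field_simp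

variable [SecondCountableTopology X]
  [IsContMDiffRiemannianBundle I ∞ (EuclideanSpace ℝ (Fin n)) (fun x : X => TangentSpace I x)]

theorem DForm.IsMeasurable.aemeasurable_rho {w : DForm I X k} (hw : w.IsMeasurable I) :
    AEMeasurable (fun x => ENNReal.ofReal (Φ (w.modulus I x))) (riemannianVolume I X) :=
  ENNReal.measurable_ofReal.comp_aemeasurable
    (Φ.continuous.measurable.comp_aemeasurable (hw.aemeasurable_modulus I))

theorem MemOrlicz.gaugeNorm_add_le {w θ : DForm I X k} (hw : MemOrlicz I Φ w)
    (hθ : MemOrlicz I Φ θ) :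
    gaugeNorm I Φ (w + θ) ≤ gaugeNorm I Φ w + gaugeNorm I Φ θ := by
  refine le_of_forall_pos_le_add fun ε hε => ?_
  set K := gaugeNorm I Φ w + ε / 2 with hK
  set L := gaugeNorm I Φ θ + ε / 2 with hL
  have hK0 : 0 < K := by have := gaugeNorm_nonneg (Φ := Φ) w; positivity
  have hL0 : 0 < L := by have := gaugeNorm_nonneg (Φ := Φ) θ; positivity
  have h1 := hw.rho_le_one (K := K) (by linarith)
  have h2 := hθ.rho_le_one (K := L) (by linarith)
  have e : gaugeNorm I Φ w + gaugeNorm I Φ θ + ε = K + L := by rw [hK, hL]; ring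
  rw [e]
  refine gaugeNorm_le (by positivity) ?_
  -- The modulus of `(w + θ) / (K + L)` is at most the convex combination of those of `w / K` and `θ
  -- / L` with weights `K / (K + L)` and `L / (K + L)`.
  have h3 : rho I Φ ((K + L)⁻¹ • (w + θ)) ≤ ENNReal.ofReal (K / (K + L)) * rho I Φ (K⁻¹ • w) +
      ENNReal.ofReal (L / (K + L)) * rho I Φ (L⁻¹ • θ) := by
    simp only [rho]
    rw [← MeasureTheory.lintegral_const_mul' _ _ ENNReal.ofReal_ne_top,
      ← MeasureTheory.lintegral_const_mul' _ _ ENNReal.ofReal_ne_top,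
      ← MeasureTheory.lintegral_add_left' ((hw.1.smul K⁻¹).aemeasurable_rho.const_mul _)]
    refine MeasureTheory.lintegral_mono fun x => ?_
    have := Φ.nonneg ((K⁻¹ • w).modulus I x)
    have := Φ.nonneg ((L⁻¹ • θ).modulus I x)
    rw [← ENNReal.ofReal_mul (by positivity), ← ENNReal.ofReal_mul (by positivity),
      ← ENNReal.ofReal_add (by positivity) (by positivity)]
    refine ENNReal.ofReal_le_ofReal ?_
    have h4 := Φ.convex.2 (Set.mem_univ ((K⁻¹ • w).modulus I x))
      (Set.mem_univ ((L⁻¹ • θ).modulus I x)) (show 0 ≤ K / (K + L) by positivity)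
      (show 0 ≤ L / (K + L) by positivity) (by field_simp)
    simp only [smul_eq_mul] at h4
    refine le_trans (Φ.mono (DForm.modulus_nonneg I _ x) ?_) h4
    rw [DForm.modulus_smul, DForm.modulus_smul, DForm.modulus_smul,
      abs_of_pos (inv_pos.2 hK0), abs_of_pos (inv_pos.2 hL0),
      abs_of_pos (inv_pos.2 (add_pos hK0 hL0))]
    calc (K + L)⁻¹ * (w + θ).modulus I x ≤ (K + L)⁻¹ * (w.modulus I x + θ.modulus I x) :=
          mul_le_mul_of_nonneg_left (DForm.modulus_add_le I w θ x) (by positivity)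
      _ = _ := by field_simp
  refine h3.trans ((add_le_add (mul_le_mul_right h1 _) (mul_le_mul_right h2 _)).trans ?_)
  rw [mul_one, mul_one, ← ENNReal.ofReal_add (by positivity) (by positivity)]
  refine ENNReal.ofReal_le_one.2 (le_of_eq (by field_simp))

theorem MemOrlicz.sub {w θ : DForm I X k} (hw : MemOrlicz I Φ w) (hθ : MemOrlicz I Φ θ) :
    MemOrlicz I Φ (w - θ) := by
  have := hw.add (hθ.smul (-1))
  rwa [neg_one_smul, ← sub_eq_add_neg] at this

/-- Apply `t ≤ Φ t + M` to `t = |w| / ε` and integrate, using `ρ(w / ε) ≤ 1`. The factor `ε` in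
front is what makes norm convergence imply local `L¹` convergence. -/
theorem MemOrlicz.setLIntegral_modulus_le {w : DForm I X k} (hw : MemOrlicz I Φ w) {M : ℝ}
    (hM0 : 0 ≤ M) (hM : ∀ t, 0 ≤ t → t ≤ Φ t + M) {ε : ℝ} (hε : gaugeNorm I Φ w < ε) (S : Set X) :
    ∫⁻ x in S, ENNReal.ofReal (w.modulus I x) ∂(riemannianVolume I X) ≤
      ENNReal.ofReal ε * (1 + ENNReal.ofReal M * riemannianVolume I X S) := by
  have hε0 : 0 < ε := (gaugeNorm_nonneg w).trans_lt hε
  calc ∫⁻ x in S, ENNReal.ofReal (w.modulus I x) ∂(riemannianVolume I X)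
      ≤ ∫⁻ x in S, ENNReal.ofReal ε * (ENNReal.ofReal (Φ ((ε⁻¹ • w).modulus I x)) +
          ENNReal.ofReal M) ∂(riemannianVolume I X) := by
        refine MeasureTheory.lintegral_mono fun x => ?_
        rw [← ENNReal.ofReal_add (Φ.nonneg _) hM0, ← ENNReal.ofReal_mul hε0.le]
        refine ENNReal.ofReal_le_ofReal ?_
        have h := hM _ (DForm.modulus_nonneg I (ε⁻¹ • w) x)
        have h' := mul_le_mul_of_nonneg_left h hε0.le
        refine le_trans (le_of_eq ?_) h'
        rw [DForm.modulus_smul, abs_of_pos (inv_pos.2 hε0)]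
        field_simp
    _ ≤ _ := by
        rw [MeasureTheory.lintegral_const_mul' _ _ ENNReal.ofReal_ne_top,
          MeasureTheory.lintegral_add_right _ measurable_const, MeasureTheory.setLIntegral_const]
        refine mul_le_mul_right (add_le_add ?_ le_rfl) _
        exact (MeasureTheory.setLIntegral_le_lintegral _ _).trans (hw.rho_le_one hε)

theorem MemOrlicz.isLocallyIntegrable [T2Space X] {w : DForm I X k} (hw : MemOrlicz I Φ w) :
    w.IsLocallyIntegrable I := by
  have := isLocallyFiniteMeasure_riemannianVolume (X := X) I
  refine ⟨hw.1, fun x => ?_⟩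
  obtain ⟨S, hS, hSf⟩ := (riemannianVolume I X).finiteAt_nhds x
  obtain ⟨M, hM0, hM⟩ := Φ.exists_le_add
  refine ⟨S, hS, (hw.1.aemeasurable_modulus I).aestronglyMeasurable.restrict, ?_⟩
  rw [MeasureTheory.hasFiniteIntegral_iff_ofReal
    (Filter.Eventually.of_forall fun x => DForm.modulus_nonneg I w x)]
  refine (hw.setLIntegral_modulus_le hM0 hM (lt_add_one _) S).trans_lt ?_
  exact ENNReal.mul_lt_top ENNReal.ofReal_lt_top (ENNReal.add_lt_top.2
    ⟨ENNReal.one_lt_top, ENNReal.mul_lt_top ENNReal.ofReal_lt_top hSf⟩)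

end

/-! ### Completeness of Orlicz spaces of forms -/

section

open Filter

variable {n : ℕ} {H : Type*} [TopologicalSpace H]
  {I : ModelWithCorners ℝ (EuclideanSpace ℝ (Fin n)) H}
  {X : Type*} [TopologicalSpace X] [ChartedSpace H X] [IsManifold I ∞ X]
  [RiemannianBundle (fun x : X => TangentSpace I x)]

theorem DForm.tendsto_modulus_sub {ι : Type*} {l : Filter ι} {k : ℕ} {u : ι → DForm I X k}
    {w : DForm I X k} {x : X} (h : Tendsto (fun i => u i x) l (𝓝 (w x))) (v : DForm I X k) :
    Tendsto (fun i => (v - u i).modulus I x) l (𝓝 ((v - w).modulus I x)) := by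
  have h1 : Tendsto (fun i => v x - u i x) l (𝓝 (v x - w x)) := tendsto_const_nhds.sub h
  exact ((continuous_formNorm_toAlternatingMap (V := TangentSpace I x) (k := k)).tendsto _).comp h1

theorem DForm.tendsto_coord {ι : Type*} {l : Filter ι} {k : ℕ} {u : ι → DForm I X k}
    {w : DForm I X k} {x : X} (h : Tendsto (fun i => u i x) l (𝓝 (w x))) (c : X) :
    Tendsto (fun i => (u i).coord I c x) l (𝓝 (w.coord I c x)) :=
  ((ContinuousAlternatingMap.compContinuousLinearMapCLM (coordFrame I c x)).continuous.tendsto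
    (w x)).comp h

variable [MeasurableSpace X] [BorelSpace X] {Φ : NFunction} {k : ℕ} [SecondCountableTopology X]
  [IsContMDiffRiemannianBundle I ∞ (EuclideanSpace ℝ (Fin n)) (fun x : X => TangentSpace I x)]

/-- A rapidly Cauchy sequence in an Orlicz space of forms converges almost everywhere. -/
theorem MemOrlicz.ae_exists_tendsto {u : ℕ → DForm I X k} (hu : ∀ i, MemOrlicz I Φ (u i))
    (h : ∀ i, gaugeNorm I Φ (u (i + 1) - u i) < (1 / 4) ^ i) :
    ∀ᵐ x ∂(riemannianVolume I X), ∃ b, Tendsto (fun i => u i x) atTop (𝓝 b) := by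
  set δ : ℕ → DForm I X k := fun i => u (i + 1) - u i with hδ
  have hδm : ∀ i, MemOrlicz I Φ (δ i) := fun i => (hu (i + 1)).sub (hu i)
  -- Half of the decay `4⁻ⁱ` is spent on summability: `ρ(2ⁱ δᵢ) ≤ 2⁻ⁱ ρ(4ⁱ δᵢ) ≤ 2⁻ⁱ`.
  have h1 : ∀ i, rho I Φ ((2 : ℝ) ^ i • δ i) ≤ (2⁻¹ : ENNReal) ^ i := by
    intro i
    have h2 := (hδm i).rho_le_one (h i)
    have h3 : (2 : ℝ) ^ i • δ i = ((1 / 2 : ℝ) ^ i) • ((1 / 4 : ℝ) ^ i)⁻¹ • δ i := by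
      rw [smul_smul, ← inv_pow, ← mul_pow]
      norm_num
    rw [h3]
    refine (rho_smul_le _ (by positivity) (pow_le_one₀ (by norm_num) (by norm_num))).trans ?_
    refine (mul_le_mul_right h2 _).trans (le_of_eq ?_)
    rw [mul_one, ENNReal.ofReal_pow (by norm_num), one_div, ENNReal.ofReal_inv_of_pos two_pos]
    simp
  have h2 : ∫⁻ x, ∑' i, ENNReal.ofReal (Φ (((2 : ℝ) ^ i • δ i).modulus I x))
      ∂(riemannianVolume I X) ≠ ⊤ := by
    rw [MeasureTheory.lintegral_tsum fun i => ((hδm i).1.smul _).aemeasurable_rho]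
    refine ne_top_of_le_ne_top ?_ (ENNReal.tsum_le_tsum h1)
    rw [ENNReal.tsum_geometric]
    simp
  obtain ⟨M, hM0, hM⟩ := Φ.exists_le_add
  filter_upwards [MeasureTheory.ae_lt_top' (AEMeasurable.tsum
    fun i => ((hδm i).1.smul _).aemeasurable_rho) h2] with x hx
  refine exists_tendsto_of_summable_formNorm (V := TangentSpace I x) (fun i => u i x) ?_
  -- The other half gives pointwise geometric decay: `2ⁱ |δᵢ|` is at most `M` plus the sum of the
  -- series, which is finite at `x`.
  have h3 : ∀ i, (δ i).modulus I x ≤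
      ((∑' i, ENNReal.ofReal (Φ (((2 : ℝ) ^ i • δ i).modulus I x))).toReal + M) * (1 / 2) ^ i := by
    intro i
    have h4 : Φ (((2 : ℝ) ^ i • δ i).modulus I x) ≤
        (∑' i, ENNReal.ofReal (Φ (((2 : ℝ) ^ i • δ i).modulus I x))).toReal :=
      (ENNReal.ofReal_le_iff_le_toReal hx.ne).1 (ENNReal.le_tsum i)
    have h5 := hM _ (DForm.modulus_nonneg I ((2 : ℝ) ^ i • δ i) x)
    rw [DForm.modulus_smul, abs_of_pos (by positivity)] at h5 h4
    rw [one_div, inv_pow, ← div_eq_mul_inv, le_div_iff₀ (by positivity), mul_comm]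
    linarith
  exact Summable.of_nonneg_of_le (fun i => DForm.modulus_nonneg I (δ i) x) h3
    (summable_geometric_two.mul_left _)

theorem MemOrlicz.exists_tendsto_gaugeNorm {u : ℕ → DForm I X k}
    (hu : ∀ i, MemOrlicz I Φ (u i))
    (h : ∀ N i j : ℕ, N ≤ i → N ≤ j → gaugeNorm I Φ (u i - u j) < (1 / 4) ^ N) :
    ∃ w, MemOrlicz I Φ w ∧ Tendsto (fun i => gaugeNorm I Φ (u i - w)) atTop (𝓝 0) := by
  classical
  have hae := MemOrlicz.ae_exists_tendsto hu fun i => h i (i + 1) i (Nat.le_succ i) le_rfl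
  set w : DForm I X k := fun x =>
    if hx : ∃ b, Tendsto (fun i => u i x) atTop (𝓝 b) then hx.choose else 0 with hw
  have hlim : ∀ᵐ x ∂(riemannianVolume I X), Tendsto (fun i => u i x) atTop (𝓝 (w x)) := by
    filter_upwards [hae] with x hx
    have : w x = hx.choose := dif_pos hx
    rw [this]
    exact hx.choose_spec
  have hwm : w.IsMeasurable I := fun c =>
    aestronglyMeasurable_of_tendsto_ae atTop (fun i => (hu i).1 c)
      (MeasureTheory.ae_restrict_of_ae (hlim.mono fun x hx => DForm.tendsto_coord hx c))
  have hm : ∀ i, (u i - w).IsMeasurable I := fun i c => ((hu i).1 c).sub (hwm c)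
  -- Fatou's lemma in `j`: the bound `ρ((uᵢ - uⱼ) / ε) ≤ 1` for `j ≥ N` passes to the almost
  -- everywhere limit `w`.
  have hrho : ∀ N i : ℕ, N ≤ i → ∀ ε : ℝ, (1 / 4) ^ N ≤ ε → rho I Φ (ε⁻¹ • (u i - w)) ≤ 1 := by
    intro N i hi ε hε
    have h1 : ∀ᵐ x ∂(riemannianVolume I X),
        ENNReal.ofReal (Φ ((ε⁻¹ • (u i - w)).modulus I x)) =
        liminf (fun j => ENNReal.ofReal (Φ ((ε⁻¹ • (u i - u j)).modulus I x))) atTop := by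
      filter_upwards [hlim] with x hx
      refine (Tendsto.liminf_eq ?_).symm
      simp only [DForm.modulus_smul]
      exact (ENNReal.continuous_ofReal.tendsto _).comp ((Φ.continuous.tendsto _).comp
        ((DForm.tendsto_modulus_sub hx (u i)).const_mul _))
    rw [rho, MeasureTheory.lintegral_congr_ae h1]
    refine (MeasureTheory.lintegral_liminf_le' fun j =>
      (((hu i).sub (hu j)).1.smul _).aemeasurable_rho).trans ?_
    refine liminf_le_of_le (by isBoundedDefault) fun b hb => ?_
    obtain ⟨j, hj, hNj⟩ := (hb.and (eventually_ge_atTop N)).exists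
    exact hj.trans (((hu i).sub (hu j)).rho_le_one ((h N i j hi hNj).trans_le hε))
  have hmem : ∀ i, MemOrlicz I Φ (u i - w) := fun i =>
    ⟨hm i, ((1 / 4 : ℝ) ^ i)⁻¹, by positivity,
      (hrho i i le_rfl _ le_rfl).trans_lt ENNReal.one_lt_top⟩
  refine ⟨w, by simpa using (hu 0).sub (hmem 0), ?_⟩
  refine squeeze_zero (fun i => gaugeNorm_nonneg _)
    (fun i => gaugeNorm_le (by positivity) (hrho i i le_rfl _ le_rfl))
    (tendsto_pow_atTop_nhds_zero_of_lt_one (by norm_num) (by norm_num))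

end

/-! ### Closedness of the weak differential and the uniform estimate -/

section

open Filter

variable {n : ℕ} {H : Type*} [TopologicalSpace H]
  {I : ModelWithCorners ℝ (EuclideanSpace ℝ (Fin n)) H}
  {X : Type*} [TopologicalSpace X] [ChartedSpace H X] [IsManifold I ∞ X]
  [RiemannianBundle (fun x : X => TangentSpace I x)]

theorem exists_abs_topIntegrand_wedge_le {j l : ℕ} (h : j + l = n) {ν : DForm I X n} {U : Set X}
    (hν : ∀ x ∈ U, ν.modulus I x = 1) {η : DForm I X l} {B : ℝ} (hB : 0 ≤ B)
    (hη : ∀ x, η.modulus I x ≤ B) :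
    ∃ C : ℝ, 0 ≤ C ∧ ∀ (w : DForm I X j), ∀ x ∈ U,
      |topIntegrand I ν (fun x => formWedge h (w x).toAlternatingMap (η x).toAlternatingMap) x| ≤
        C * w.modulus I x := by
  obtain ⟨C, hC0, hC⟩ := formNorm_wedge_le h n
  refine ⟨C * B, by positivity, fun w x hx => ?_⟩
  have hfin : Module.finrank ℝ (TangentSpace I x) = n := finrank_euclideanSpace_fin
  have h1 := hC (V := TangentSpace I x) hfin (w x).toAlternatingMap (η x).toAlternatingMap
  have h2 := abs_formInner_le (V := TangentSpace I x)
    (formWedge h (w x).toAlternatingMap (η x).toAlternatingMap) (ν x).toAlternatingMap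
  have h3 : formNorm (V := TangentSpace I x) (ν x).toAlternatingMap = 1 := hν x hx
  rw [h3, mul_one] at h2
  have hw0 := DForm.modulus_nonneg I w x
  calc _ ≤ _ := h2
    _ ≤ C * w.modulus I x * η.modulus I x := h1
    _ ≤ C * w.modulus I x * B := mul_le_mul_of_nonneg_left (hη x) (by positivity)
    _ = _ := by ring

theorem topIntegrand_wedge_eq_zero {j l : ℕ} (h : j + l = n) (ν : DForm I X n) (w : DForm I X j)
    {η : DForm I X l} {x : X} (hη : η x = 0) :
    topIntegrand I ν (fun x => formWedge h (w x).toAlternatingMap (η x).toAlternatingMap) x = 0 := by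
  obtain ⟨C, hC0, hC⟩ := formNorm_wedge_le h n
  have hfin : Module.finrank ℝ (TangentSpace I x) = n := finrank_euclideanSpace_fin
  have h1 := hC (V := TangentSpace I x) hfin (w x).toAlternatingMap (η x).toAlternatingMap
  have h2 := abs_formInner_le (V := TangentSpace I x)
    (formWedge h (w x).toAlternatingMap (η x).toAlternatingMap) (ν x).toAlternatingMap
  have h3 : formNorm (V := TangentSpace I x) (η x).toAlternatingMap = 0 := by
    have := DForm.modulus_zero (I := I) (k := l) x
    rw [DForm.modulus] at this
    rw [hη]
    exact this
  rw [h3, mul_zero] at h1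
  refine abs_nonpos_iff.1 (h2.trans ?_)
  exact mul_nonpos_of_nonpos_of_nonneg h1 (formNorm_nonneg _)

variable [MeasurableSpace X] [BorelSpace X] {Φ : NFunction} {k : ℕ} [SecondCountableTopology X]
  [IsContMDiffRiemannianBundle I ∞ (EuclideanSpace ℝ (Fin n)) (fun x : X => TangentSpace I x)]
  [T2Space X]

/-- Convergence in the gauge norm implies convergence in `L¹` on compact sets. -/
theorem tendsto_setLIntegral_modulus {u : ℕ → DForm I X k} (hu : ∀ i, MemOrlicz I Φ (u i))
    (h : Tendsto (fun i => gaugeNorm I Φ (u i)) atTop (𝓝 0)) {K : Set X} (hK : IsCompact K) :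
    Tendsto (fun i => ∫⁻ x in K, ENNReal.ofReal ((u i).modulus I x) ∂(riemannianVolume I X))
      atTop (𝓝 0) := by
  have := isLocallyFiniteMeasure_riemannianVolume (X := X) I
  obtain ⟨M, hM0, hM⟩ := Φ.exists_le_add
  have hfin : 1 + ENNReal.ofReal M * riemannianVolume I X K ≠ ⊤ :=
    ENNReal.add_ne_top.2 ⟨ENNReal.one_ne_top,
      ENNReal.mul_ne_top ENNReal.ofReal_ne_top hK.measure_lt_top.ne⟩
  refine tendsto_of_tendsto_of_tendsto_of_le_of_le tendsto_const_nhds (h := fun i : ℕ =>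
    ENNReal.ofReal (gaugeNorm I Φ (u i) + 1 / ((i : ℝ) + 1)) *
      (1 + ENNReal.ofReal M * riemannianVolume I X K)) ?_ (fun _ => zero_le)
    fun i => (hu i).setLIntegral_modulus_le hM0 hM (lt_add_of_pos_right _ (by positivity)) K
  have h1 : Tendsto (fun i : ℕ => ENNReal.ofReal (gaugeNorm I Φ (u i) + 1 / ((i : ℝ) + 1)))
      atTop (𝓝 0) := by
    rw [← ENNReal.ofReal_zero]
    refine (ENNReal.continuous_ofReal.tendsto _).comp ?_
    simpa using h.add tendsto_one_div_add_atTop_nhds_zero_nat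
  simpa using ENNReal.Tendsto.mul_const h1 (Or.inr hfin)

/-- The pairing with a bounded form of compact support is continuous for the gauge norm. -/
theorem tendsto_setIntegral_topIntegrand {j l : ℕ} (h : j + l = n) {ν : DForm I X n} {U : Set X}
    (hU : IsOpen U) (hν : ∀ x ∈ U, ν.modulus I x = 1) {η : DForm I X l} {B : ℝ} (hB : 0 ≤ B)
    (hη : ∀ x, η.modulus I x ≤ B) {K : Set X} (hK : IsCompact K) (hηK : ∀ x ∉ K, η x = 0)
    {u : ℕ → DForm I X j} {w : DForm I X j} (hu : ∀ i, MemOrlicz I Φ (u i))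
    (hw : MemOrlicz I Φ w) (hlim : Tendsto (fun i => gaugeNorm I Φ (u i - w)) atTop (𝓝 0))
    (hint : ∀ i, MeasureTheory.IntegrableOn (topIntegrand I ν fun x =>
      formWedge h (u i x).toAlternatingMap (η x).toAlternatingMap) U (riemannianVolume I X)) :
    MeasureTheory.IntegrableOn (topIntegrand I ν fun x =>
      formWedge h (w x).toAlternatingMap (η x).toAlternatingMap) U (riemannianVolume I X) ∧
    Tendsto (fun i => ∫ x in U, topIntegrand I ν (fun x =>
        formWedge h (u i x).toAlternatingMap (η x).toAlternatingMap) x ∂(riemannianVolume I X))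
      atTop (𝓝 (∫ x in U, topIntegrand I ν (fun x =>
        formWedge h (w x).toAlternatingMap (η x).toAlternatingMap) x ∂(riemannianVolume I X))) := by
  set μ := riemannianVolume I X with hμ
  set F : DForm I X j → X → ℝ := fun v => topIntegrand I ν fun x =>
      formWedge h (v x).toAlternatingMap (η x).toAlternatingMap with hF
  change MeasureTheory.IntegrableOn (F w) U μ ∧ Tendsto (fun i => ∫ x in U, F (u i) x ∂μ) atTop
    (𝓝 (∫ x in U, F w x ∂μ))
  have hint' : ∀ i, MeasureTheory.IntegrableOn (F (u i)) U μ := hint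
  obtain ⟨C, hC0, hC⟩ := exists_abs_topIntegrand_wedge_le h hν hB hη
  have hFC : ∀ (v : DForm I X j), ∀ x ∈ U, |F v x| ≤ C * v.modulus I x := fun v => hC v
  have hF0 : ∀ (v : DForm I X j), ∀ x ∉ K, F v x = 0 := fun v x hx =>
    topIntegrand_wedge_eq_zero h ν v (hηK x hx)
  have hFsub : ∀ i x, F (u i) x - F w x = F (u i - w) x := fun i x => by
    have := congrFun (topIntegrand_wedge_add h ν w (u i - w) η) x
    rw [add_sub_cancel] at this
    have h' : F (u i) x = F w x + F (u i - w) x := this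
    rw [h']
    ring
  have hFb : ∀ (v : DForm I X j), ∀ x ∈ U,
      |F v x| ≤ K.indicator (fun x => C * v.modulus I x) x := by
    intro v x hx
    by_cases hxK : x ∈ K
    · rw [Set.indicator_of_mem hxK]
      exact hFC v x hx
    · rw [Set.indicator_of_notMem hxK, hF0 v x hxK, abs_zero]
  have hd : ∀ i, MemOrlicz I Φ (u i - w) := fun i => (hu i).sub hw
  have hL1 := tendsto_setLIntegral_modulus hd hlim hK
  have hKm : MeasurableSet K := hK.measurableSet
  have hUm : MeasurableSet U := hU.measurableSet
  -- Measurability of the limit integrand is inherited from the approximants: `L¹` convergence on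
  -- `K` gives convergence in measure, and a subsequence of the integrands converges almost
  -- everywhere on `U`.
  have haem : MeasureTheory.AEStronglyMeasurable (F w) (μ.restrict U) := by
    have hmeas : MeasureTheory.TendstoInMeasure (μ.restrict K)
        (fun i => (u i - w).modulus I) atTop (fun _ => 0) := by
      refine MeasureTheory.tendstoInMeasure_of_tendsto_eLpNorm one_ne_zero (fun i =>
        ((hd i).1.aemeasurable_modulus I).aestronglyMeasurable.restrict)
        MeasureTheory.aestronglyMeasurable_const ?_
      refine hL1.congr fun i => ?_
      rw [MeasureTheory.eLpNorm_one_eq_lintegral_enorm]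
      refine MeasureTheory.lintegral_congr fun x => ?_
      rw [Pi.sub_apply, sub_zero, Real.enorm_of_nonneg (DForm.modulus_nonneg I _ x)]
    obtain ⟨ns, -, hns⟩ := hmeas.exists_seq_tendsto_ae
    refine aestronglyMeasurable_of_tendsto_ae atTop (fun i => (hint' (ns i)).1) ?_
    filter_upwards [MeasureTheory.ae_restrict_mem hUm, MeasureTheory.ae_restrict_of_ae
      ((MeasureTheory.ae_restrict_iff' hKm).1 hns)] with x hxU hx
    rw [tendsto_iff_norm_sub_tendsto_zero]
    by_cases hxK : x ∈ K
    · refine squeeze_zero (fun _ => norm_nonneg _) (fun i => ?_)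
        (by simpa using (hx hxK).const_mul C)
      rw [hFsub, Real.norm_eq_abs]
      exact hFC _ x hxU
    · simp [hF0 _ x hxK]
  have hwint : MeasureTheory.IntegrableOn (F w) U μ := by
    have h1 : MeasureTheory.Integrable (K.indicator fun x => C * w.modulus I x) μ :=
      (MeasureTheory.integrable_indicator_iff hKm).2
        ((hw.isLocallyIntegrable.2.integrableOn_isCompact hK).const_mul C)
    refine h1.integrableOn.mono' haem ?_
    filter_upwards [MeasureTheory.ae_restrict_mem hUm] with x hx
    exact hFb w x hx
  refine ⟨hwint, MeasureTheory.tendsto_integral_of_L1 _ hwint.aestronglyMeasurable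
    (Eventually.of_forall fun i => hint' i) ?_⟩
  have h2 : ∀ i, ∫⁻ x in U, ‖F (u i) x - F w x‖ₑ ∂μ ≤
      ENNReal.ofReal C * ∫⁻ x in K, ENNReal.ofReal ((u i - w).modulus I x) ∂μ := by
    intro i
    rw [← MeasureTheory.lintegral_const_mul' _ _ ENNReal.ofReal_ne_top,
      ← MeasureTheory.lintegral_indicator hKm]
    refine le_trans (MeasureTheory.setLIntegral_mono' hUm fun x hx => ?_)
      (MeasureTheory.setLIntegral_le_lintegral U _)
    rw [hFsub, ← ofReal_norm]
    by_cases hxK : x ∈ K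
    · rw [Set.indicator_of_mem hxK, ← ENNReal.ofReal_mul hC0]
      exact ENNReal.ofReal_le_ofReal (hFC _ x hx)
    · rw [hF0 _ x hxK]
      simp
  refine tendsto_of_tendsto_of_tendsto_of_le_of_le tendsto_const_nhds ?_ (fun _ => zero_le) h2
  simpa using ENNReal.Tendsto.const_mul hL1 (Or.inr ENNReal.ofReal_ne_top)

/-- The weak differential is a closed operator between Orlicz spaces. -/
theorem IsWeakDifferential.of_tendsto {Φ₁ Φ₂ : NFunction} {j : ℕ} {u : ℕ → DForm I X j}
    {v : ℕ → DForm I X (j + 1)} {w : DForm I X j} {θ : DForm I X (j + 1)}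
    (hd : ∀ i, IsWeakDifferential I (u i) (v i))
    (hu : ∀ i, MemOrlicz I Φ₁ (u i)) (hv : ∀ i, MemOrlicz I Φ₂ (v i))
    (hw : MemOrlicz I Φ₁ w) (hθ : MemOrlicz I Φ₂ θ)
    (hlw : Tendsto (fun i => gaugeNorm I Φ₁ (u i - w)) atTop (𝓝 0))
    (hlθ : Tendsto (fun i => gaugeNorm I Φ₂ (v i - θ)) atTop (𝓝 0)) :
    IsWeakDifferential I w θ := by
  refine ⟨hw.isLocallyIntegrable, hθ.isLocallyIntegrable, ?_⟩
  intro m h₁ h₂ U hU hUc hUi ν hν φ hφ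
  obtain ⟨B, hB0, hB₁, hB₂⟩ := hφ.exists_modulus_le
  have hsupp : ∀ x ∉ closure {x | φ x ≠ 0}, φ x = 0 := fun x hx => by
    by_contra h
    exact hx (subset_closure h)
  have hi := fun i => (hd i).2.2 m h₁ h₂ U hU hUc hUi ν hν φ hφ
  obtain ⟨hf, hft⟩ := tendsto_setIntegral_topIntegrand h₁ hU hν.2 hB0 hB₂ hφ.2.1
    (fun x hx => DForm.extDiff_eq_zero_of_notMem_closure I hx) hu hw hlw fun i => (hi i).1
  obtain ⟨hg, hgt⟩ := tendsto_setIntegral_topIntegrand h₂ hU hν.2 hB0 hB₁ hφ.2.1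
    hsupp hv hθ hlθ fun i => (hi i).2.1
  -- Both sides of the identity for `(u i, v i)` converge, so their limits agree.
  exact ⟨hf, hg, tendsto_nhds_unique hft
    ((hgt.const_mul ((-1) ^ (j + 1))).congr fun i => (hi i).2.2.symm)⟩

variable (I X) in
/-- Pairs `(θ, w)` with `θ ∈ L^{Φ₁}`, `w ∈ Z_{Φ₂}` and `dθ = w`: the graph of the weak
differential. -/
noncomputable def weakDifferentialGraph (Φ₁ Φ₂ : NFunction) (k : ℕ) :
    Submodule ℝ (DForm I X k × DForm I X (k + 1)) where
  carrier := {p | MemOrlicz I Φ₁ p.1 ∧ p.2 ∈ orliczCocycles I X Φ₂ (k + 1) ∧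
    IsWeakDifferential I p.1 p.2}
  add_mem' h h' := ⟨h.1.add h'.1, Submodule.add_mem _ h.2.1 h'.2.1, h.2.2.add h'.2.2⟩
  zero_mem' := ⟨.zero Φ₁, Submodule.zero_mem _, .zero⟩
  smul_mem' r _ h := ⟨h.1.smul r, Submodule.smul_mem _ r h.2.1, h.2.2.smul r⟩

variable (I X) in
/-- The graph norm `‖θ‖_{(Φ₁)} + ‖dθ‖_{(Φ₂)}`. -/
noncomputable def graphSeminorm (Φ₁ Φ₂ : NFunction) (k : ℕ) : Seminorm ℝ (weakDifferentialGraph I X Φ₁ Φ₂ k) :=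
  Seminorm.of (fun p => gaugeNorm I Φ₁ p.1.1 + gaugeNorm I Φ₂ p.1.2)
    (fun p q => by
      have h₁ := p.2.1.gaugeNorm_add_le q.2.1
      have h₂ := p.2.2.1.1.gaugeNorm_add_le q.2.2.1.1
      calc _ ≤ _ := add_le_add h₁ h₂
        _ = _ := by ring)
    (fun r p => by
      have h₁ := p.2.1.gaugeNorm_smul r
      have h₂ := p.2.2.1.1.gaugeNorm_smul r
      calc _ = _ := congrArg₂ (· + ·) h₁ h₂
        _ = _ := by rw [Real.norm_eq_abs]; ring)

variable (I X) in
/-- The gauge norm on cocycles. -/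
noncomputable def cocycleSeminorm (Φ : NFunction) (k : ℕ) : Seminorm ℝ (orliczCocycles I X Φ k) :=
  Seminorm.of (fun w => gaugeNorm I Φ w.1) (fun w v => w.2.1.gaugeNorm_add_le v.2.1)
    (fun r w => w.2.1.gaugeNorm_smul r)

/-- Closedness of `d` along the constant sequence `d (u i) = 0`. -/
theorem mem_orliczCocycles_of_tendsto {u : ℕ → DForm I X k} {w : DForm I X k}
    (hu : ∀ i, u i ∈ orliczCocycles I X Φ k) (hw : MemOrlicz I Φ w)
    (hl : Tendsto (fun i => gaugeNorm I Φ (u i - w)) atTop (𝓝 0)) :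
    w ∈ orliczCocycles I X Φ k :=
  ⟨hw, IsWeakDifferential.of_tendsto (Φ₂ := Φ) (fun i => (hu i).2) (fun i => (hu i).1)
    (fun _ => .zero Φ) hw (.zero Φ) hl (by simp [gaugeNorm_zero])⟩

theorem completeSeq_cocycleSeminorm (Φ : NFunction) (k : ℕ) :
    (cocycleSeminorm I X Φ k).CompleteSeq := by
  intro u hu
  have h : ∀ N i j : ℕ, N ≤ i → N ≤ j →
      gaugeNorm I Φ ((u i).1 - (u j).1) < (1 / 4) ^ N := hu
  obtain ⟨w, hw, hwl⟩ := MemOrlicz.exists_tendsto_gaugeNorm (fun i => (u i).2.1) h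
  exact ⟨⟨w, mem_orliczCocycles_of_tendsto (fun i => (u i).2) hw hwl⟩, hwl⟩

theorem completeSeq_graphSeminorm (Φ₁ Φ₂ : NFunction) (k : ℕ) :
    (graphSeminorm I X Φ₁ Φ₂ k).CompleteSeq := by
  intro u hu
  have h : ∀ N i j : ℕ, N ≤ i → N ≤ j → gaugeNorm I Φ₁ ((u i).1.1 - (u j).1.1) +
      gaugeNorm I Φ₂ ((u i).1.2 - (u j).1.2) < (1 / 4) ^ N := hu
  obtain ⟨θ, hθ, hθl⟩ := MemOrlicz.exists_tendsto_gaugeNorm (fun i => (u i).2.1)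
    fun N i j hi hj => (le_add_of_nonneg_right (gaugeNorm_nonneg _)).trans_lt (h N i j hi hj)
  obtain ⟨w, hw, hwl⟩ := MemOrlicz.exists_tendsto_gaugeNorm (fun i => (u i).2.2.1.1)
    fun N i j hi hj => (le_add_of_nonneg_left (gaugeNorm_nonneg _)).trans_lt (h N i j hi hj)
  refine ⟨⟨(θ, w), hθ, mem_orliczCocycles_of_tendsto (fun i => (u i).2.2.1) hw hwl,
    IsWeakDifferential.of_tendsto (fun i => (u i).2.2.2)
    (fun i => (u i).2.1) (fun i => (u i).2.2.1.1) hθ hw hθl hwl⟩, ?_⟩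
  rw [← add_zero (0 : ℝ)]
  exact hθl.add hwl

theorem subsingleton_orliczCohomology_iff (Φ₁ Φ₂ : NFunction) (k : ℕ) :
    Subsingleton (orliczCohomology I X Φ₁ Φ₂ k) ↔
      orliczCocycles I X Φ₂ k ≤ orliczCoboundaries I X Φ₁ Φ₂ k := by
  rw [Submodule.Quotient.subsingleton_iff, Submodule.submoduleOf,
    Submodule.comap_subtype_eq_top]

theorem exists_primitive_gaugeNorm_le {Φ₁ Φ₂ : NFunction} {k : ℕ}
    (h : orliczCocycles I X Φ₂ (k + 1) ≤ orliczCoboundaries I X Φ₁ Φ₂ (k + 1)) :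
    ∃ C : ℝ, ∀ w : DForm I X (k + 1), MemOrlicz I Φ₂ w → IsWeakDifferential I w 0 →
      ∃ θ : DForm I X k, MemOrlicz I Φ₁ θ ∧ IsWeakDifferential I θ w ∧
        gaugeNorm I Φ₁ θ ≤ C * gaugeNorm I Φ₂ w := by
  let f : weakDifferentialGraph I X Φ₁ Φ₂ k →ₗ[ℝ] orliczCocycles I X Φ₂ (k + 1) :=
    { toFun := fun p => ⟨p.1.2, p.2.2.1⟩
      map_add' := fun _ _ => rfl
      map_smul' := fun _ _ => rfl }
  have hf : Function.Surjective f := by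
    rintro ⟨w, hw⟩
    obtain ⟨-, θ, hθ, hθd⟩ := h hw
    exact ⟨⟨(θ, w), hθ, hw, hθd⟩, rfl⟩
  obtain ⟨C, hC⟩ := Seminorm.exists_preimage_le (graphSeminorm I X Φ₁ Φ₂ k)
    (cocycleSeminorm I X Φ₂ (k + 1)) (completeSeq_graphSeminorm Φ₁ Φ₂ k)
    (completeSeq_cocycleSeminorm Φ₂ (k + 1)) f
    (fun p => le_add_of_nonneg_left (gaugeNorm_nonneg p.1.1)) hf
  refine ⟨C, fun w hw hd => ?_⟩
  obtain ⟨⟨⟨θ, w'⟩, hθ, hw', hθd⟩, h0, hle⟩ := hC ⟨w, hw, hd⟩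
  have h0' : gaugeNorm I Φ₂ (w' - w) = 0 := h0
  have hle' : gaugeNorm I Φ₁ θ + gaugeNorm I Φ₂ w' ≤ C * gaugeNorm I Φ₂ w := hle
  refine ⟨θ, hθ, ?_, (le_add_of_nonneg_right (gaugeNorm_nonneg w')).trans hle'⟩
  -- The constant sequence `w'` converges to `w` because `‖w' - w‖ = 0`, so closedness of `d`
  -- replaces `dθ = w'` by `dθ = w`.
  refine IsWeakDifferential.of_tendsto (u := fun _ => θ) (v := fun _ => w') (fun _ => hθd)
    (fun _ => hθ) (fun _ => hw'.1) hθ hw ?_ ?_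
  · simp [gaugeNorm_zero]
  · simp [h0']

end

/-! ### Vanishing of cohomology and bounded primitives -/

theorem mainTheorem5 {n : ℕ} {H : Type*} [TopologicalSpace H]
    (I : ModelWithCorners ℝ (EuclideanSpace ℝ (Fin n)) H)
    (X : Type*) [TopologicalSpace X] [ChartedSpace H X] [IsManifold I ∞ X]
    [T2Space X] [SecondCountableTopology X] [MeasurableSpace X] [BorelSpace X]
    [RiemannianBundle (fun x : X => TangentSpace I x)]
    [IsContMDiffRiemannianBundle I ∞ (EuclideanSpace ℝ (Fin n)) (fun x : X => TangentSpace I x)]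
    (Φ₁ Φ₂ : NFunction) (k : ℕ) :
    Subsingleton (orliczCohomology I X Φ₁ Φ₂ k) ↔
      ∃ C : ℝ, ∀ w : DForm I X k, MemOrlicz I Φ₂ w → IsWeakDifferential I w 0 →
        ∃ θ : PrevDForm I X k, MemOrliczPrev I Φ₁ k θ ∧ IsWeakDifferentialPrev I k θ w ∧
          gaugeNormPrev I Φ₁ k θ ≤ C * gaugeNorm I Φ₂ w := by
  rw [subsingleton_orliczCohomology_iff]
  constructor
  · intro h
    cases k with
    | zero =>
      -- In degree `0` the norm of the primitive is `0` by definition, so any constant `C ≥ 0`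
      -- works.
      refine ⟨0, fun w hw hd => ?_⟩
      obtain ⟨-, θ, hθ, hθd⟩ := h (show w ∈ orliczCocycles I X Φ₂ 0 from ⟨hw, hd⟩)
      exact ⟨θ, hθ, hθd, (zero_mul _).ge⟩
    | succ k => exact exists_primitive_gaugeNorm_le h
  · rintro ⟨C, hC⟩ w ⟨hw, hd⟩
    obtain ⟨θ, hθ, hθd, -⟩ := hC w hw hd
    exact ⟨hw, θ, hθ, hθd⟩
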